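/- Let $\mathfrak M$ be a $W^*$-algebra, $\mathcal L(\mathfrak M)$ its set of orthogonal projections, and for $x\in\mathfrak M$ let $l(x)$, $r(x)$ be the smallest projections with $l(x)x=x$, $x\,r(x)=x$. Let $\mathcal U(\mathfrak M)$ be the set of partial isometries and $\mathcal G(\mathfrak M)$ the set of $x\in\mathfrak M$ such that $|x|$ is invertible in $p\mathfrak Mp$, where $p$ is the support of $|x|$. $\mathcal G(\mathfrak M)$ is a groupoid with base $\mathcal L(\mathfrak M)$, source $r$, target $l$, the product of $\mathfrak M$, and inversion $\iota(x)=|x|^{-1}u^*$, where $x=u|x|$ is the polar decomposition and $|x|^{-1}$ is the inverse in $p\mathfrak Mp$. Put $J(x)=\iota(x)^*$. Call $\tilde p,p\in\mathcal L(\mathfrak M)$ equivalent if $\tilde p=l(x)$, $p=r(x)$ for some $x\in\mathcal G(\mathfrak M)$. Let $\Pi_p$ be the set of projections $q$ with $\mathfrak M=q\mathfrak M\oplus(1-p)\mathfrak M$. For $q\in\Pi_p$ write $p=\sigma_p(q)-\varphi_p(q)$ with $\sigma_p(q)\in q\mathfrak Mp$ and $\varphi_p(q)\in(1-p)\mathfrak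 Mp$. For equivalent $\tilde p,p$ put $\Omega_{\tilde pp}=\{x\in\mathcal G(\mathfrak M): l(x)\in\Pi_{\tilde p},\ r(x)\in\Pi_p\}$ and $$\psi_{\tilde pp}(x)=\bigl(\varphi_{\tilde p}(l(x)),\ \iota(\sigma_{\tilde p}(l(x)))\,x\,\sigma_p(r(x)),\ \varphi_p(r(x))\bigr)\in(1-\tilde p)\mathfrak M\tilde p\oplus\tilde p\mathfrak Mp\oplus(1-p)\mathfrak Mp .$$ The charts $(\Omega_{\tilde pp},\psi_{\tilde pp})$ form a complex analytic atlas, which makes $\mathcal G(\mathfrak M)$ a (Hausdorff) complex Banach manifold (the model space may vary with the chart). Moreover: (i) $\mathcal U(\mathfrak M)$ has a natural structure of a real (analytic) Banach manifold, namely the one induced from $\mathcal G(\mathfrak M)$ as in (ii). Its model spaces are the real Banach spaces $$(1-\tilde p)\mathfrak M\tilde p\ \oplus\ p\mathfrak M^hp\ \oplus\ (1-p)\mathfrak Mp$$ for equivalent pairs $(\tilde p,p)$, where $\mathfrak M^h$ is the space of self-adjoint elements: there is an atlas each of whose charts has a domain in $\Omega_{\tilde pp}$ and a model space isomorphic to this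 space, for some equivalent pair; and for every equivalent pair $(\tilde p,p)$, such charts for this pair cover $\mathcal U(\mathfrak M)\cap\Omega_{\tilde pp}$. (ii) $\mathcal U(\mathfrak M)$ is a closed (split) submanifold of the real Banach manifold underlying $\mathcal G(\mathfrak M)$. It is the set of fixed points of $J$, which is an involution of $\mathcal G(\mathfrak M)$. (iii) For all projections $\tilde p,p$, the set $\mathcal G(\mathfrak M)_p^{\tilde p}=\{x\in\mathcal G(\mathfrak M): l(x)=\tilde p,\ r(x)=p\}$ is open in the complex Banach space $\tilde p\mathfrak Mp$, and as a complex manifold it is a complexification of $\mathcal U(\mathfrak M)\cap\mathcal G(\mathfrak M)_p^{\tilde p}$: around each point of the latter there is a holomorphic chart of $\mathcal G(\mathfrak M)_p^{\tilde p}$ into a complex Banach space $E=F\oplus iF$, with $F$ a closed real subspace, in which $\mathcal U(\mathfrak M)\cap\mathcal G(\mathfrak M)_p^{\tilde p}$ is given by $F$. -/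

import Mathlib

universe u

namespace BanachManifold

/-! Manifolds modelled on families of Banach spaces: the model space may change from chart to
chart. The structure on a set `X` is given by an analytic atlas, and the topology comes from it. -/

/-- A map from a subset `source` of `X` to a Banach space `Model` over `𝕜`
(only the values of `toFun` on `source` matter). -/
structure CoordMap (𝕜 : Type) [NontriviallyNormedField 𝕜] (X : Type u) where
  Model : Type u
  [instGroup : NormedAddCommGroup Model]
  [instSpace : NormedSpace 𝕜 Model]
  [instComplete : CompleteSpace Model]
  source : Set X
  toFun : X → Model

attribute [instance] CoordMap.instGroup CoordMap.instSpace CoordMap.instComplete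

/-- A chart: a bijection of `source` onto an open subset of the model space. -/
def CoordMap.IsChart {𝕜 : Type} [NontriviallyNormedField 𝕜] {X : Type u}
    (c : CoordMap 𝕜 X) : Prop :=
  Set.InjOn c.toFun c.source ∧ IsOpen (c.toFun '' c.source)

/-- The overlap of `c` and `d` is open in the coordinates of `c`, and the transition map from the
coordinates of `c` to those of `d` is analytic there. -/
def CoordMap.AnalyticTransition {𝕜 : Type} [NontriviallyNormedField 𝕜] {X : Type u}
    (c d : CoordMap 𝕜 X) : Prop :=
  IsOpen (c.toFun '' (c.source ∩ d.source)) ∧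
    ∃ τ : c.Model → d.Model, AnalyticOnNhd 𝕜 τ (c.toFun '' (c.source ∩ d.source)) ∧
      ∀ x ∈ c.source ∩ d.source, τ (c.toFun x) = d.toFun x

/-- The topology of `X` defined by a set of charts. -/
@[reducible]
def atlasTopology {𝕜 : Type} [NontriviallyNormedField 𝕜] {X : Type u}
    (A : Set (CoordMap 𝕜 X)) : TopologicalSpace X :=
  TopologicalSpace.generateFrom
    {W | ∃ c ∈ A, ∃ V : Set c.Model, IsOpen V ∧ W = c.source ∩ c.toFun ⁻¹' V}

/-- `A` is an analytic atlas on `X`, making `X` a (Hausdorff) Banach manifold over `𝕜`. -/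
structure IsBanachAtlas {𝕜 : Type} [NontriviallyNormedField 𝕜] {X : Type u}
    (A : Set (CoordMap 𝕜 X)) : Prop where
  covers : ∀ x : X, ∃ c ∈ A, x ∈ c.source
  isChart : ∀ c ∈ A, c.IsChart
  compatible : ∀ c ∈ A, ∀ d ∈ A, c.AnalyticTransition d
  hausdorff : @T2Space X (atlasTopology A)

/-- The charts of the manifold: those compatible with all the charts of the atlas. -/
def maximalAtlas {𝕜 : Type} [NontriviallyNormedField 𝕜] {X : Type u}
    (A : Set (CoordMap 𝕜 X)) : Set (CoordMap 𝕜 X) :=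
  {c | c.IsChart ∧ ∀ d ∈ A, c.AnalyticTransition d ∧ d.AnalyticTransition c}

/-- The charts induced on a subset `Y`: the restrictions to `Y` of those charts `c` of `X` which
map the part of `Y` in their domain onto the intersection of their image with a closed complemented
subspace `F` of the model space. Here `F` is the range of the embedding `j`, through which the
Banach space `d.Model` is identified with `F`. -/
def inducedCharts {𝕜 : Type} [NontriviallyNormedField 𝕜] {X : Type u}
    (A : Set (CoordMap 𝕜 X)) (Y : Set X) : Set (CoordMap 𝕜 Y) :=
  {d | ∃ c ∈ maximalAtlas A, ∃ j : d.Model →L[𝕜] c.Model,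
    Function.Injective j ∧ IsClosed (Set.range j) ∧
    (LinearMap.range j.toLinearMap).ClosedComplemented ∧
    d.source = Subtype.val ⁻¹' c.source ∧
    (∀ y ∈ d.source, j (d.toFun y) = c.toFun y) ∧
    c.toFun '' (c.source ∩ Y) = c.toFun '' c.source ∩ Set.range j}

/-- `Y` is a (split) submanifold of `X`. -/
def IsSubmanifold {𝕜 : Type} [NontriviallyNormedField 𝕜] {X : Type u}
    (A : Set (CoordMap 𝕜 X)) (Y : Set X) : Prop :=
  ∀ y : Y, ∃ d ∈ inducedCharts A Y, y ∈ d.source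

/-- A complex coordinate map, seen as a real one. -/
noncomputable def CoordMap.toReal {X : Type u} (c : CoordMap ℂ X) : CoordMap ℝ X where
  Model := c.Model
  source := c.source
  toFun := c.toFun

/-- The atlas of the real manifold underlying a complex manifold. -/
noncomputable def realAtlas {X : Type u} (A : Set (CoordMap ℂ X)) : Set (CoordMap ℝ X) :=
  CoordMap.toReal '' A

/-- The complex manifold `X` is a complexification of its subset `Y`: around each point of `Y` there
is a holomorphic chart of `X` in which `Y` is given by a closed real subspace `F` of the model
space `E`, where `E = F ⊕ iF`. -/
def IsComplexificationOf {X : Type u} (A : Set (CoordMap ℂ X)) (Y : Set X) : Prop :=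
  ∀ y ∈ Y, ∃ c ∈ maximalAtlas A, y ∈ c.source ∧
    ∃ F : Submodule ℝ c.Model, IsClosed (F : Set c.Model) ∧
      (∀ v : c.Model, ∃! ab : F × F, v = (ab.1 : c.Model) + Complex.I • (ab.2 : c.Model)) ∧
      c.toFun '' (c.source ∩ Y) = c.toFun '' c.source ∩ F

end BanachManifold

namespace WStarGroupoid

open BanachManifold

/-- The set of orthogonal projections. -/
abbrev Proj (M : Type u) [CStarAlgebra M] : Type u := {p : M // IsStarProjection p}

/-- The set of partial isometries. -/
def partialIsometries (M : Type u) [CStarAlgebra M] : Set M :=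
  {v | IsStarProjection (star v * v)}

variable {M : Type u} [CStarAlgebra M]

/-- `a M b`, for idempotents `a` and `b`. -/
def corner (a b : M) : Submodule ℂ M where
  carrier := {m | a * m * b = m}
  add_mem' {x y} hx hy := by
    change a * (x + y) * b = x + y
    rw [mul_add, add_mul, show a * x * b = x from hx, show a * y * b = y from hy]
  zero_mem' := by simp
  smul_mem' c x hx := by
    change a * (c • x) * b = c • x
    rw [mul_smul_comm, smul_mul_assoc, show a * x * b = x from hx]

/-- `p Mʰ p`, for a projection `p`: the self-adjoint elements of `p M p`. -/
def hermCorner (p : Proj M) : Submodule ℝ M where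
  carrier := {m | (p : M) * m * p = m ∧ IsSelfAdjoint m}
  add_mem' {x y} hx hy := by
    refine ⟨?_, hx.2.add hy.2⟩
    rw [mul_add, add_mul, hx.1, hy.1]
  zero_mem' := by simp
  smul_mem' c x hx := by
    refine ⟨?_, (IsSelfAdjoint.all c).smul hx.2⟩
    rw [mul_smul_comm, smul_mul_assoc, hx.1]

theorem isClosed_corner (a b : M) : IsClosed (corner a b : Set M) :=
  isClosed_eq (by fun_prop) continuous_id

theorem isClosed_hermCorner (p : Proj M) : IsClosed (hermCorner p : Set M) :=
  (isClosed_eq (by fun_prop) continuous_id).inter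
    (isClosed_eq continuous_star continuous_id)

instance (a b : M) : CompleteSpace (corner a b) :=
  (isClosed_corner a b).completeSpace_coe

instance (p : Proj M) : CompleteSpace (hermCorner p) :=
  (isClosed_hermCorner p).completeSpace_coe

/-- The compression `m ↦ p m q` onto `p M q`. -/
def compress (p q : Proj M) (m : M) : corner (p : M) (q : M) :=
  ⟨p * m * q, by
    change (p : M) * (p * m * q) * q = p * m * q
    have hp : (p : M) * p = p := p.2.isIdempotentElem
    have hq : (q : M) * q = q := q.2.isIdempotentElem
    rw [← mul_assoc, ← mul_assoc, hp, mul_assoc, hq]⟩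

open Classical in
/-- The left support: the smallest projection `p` with `p x = x` (which exists in a `W⋆`-algebra;
`e ≤ f` means `e f = e`). -/
noncomputable def leftSupport (x : M) : Proj M :=
  if h : ∃ p : Proj M, (p : M) * x = x ∧ ∀ e : Proj M, (e : M) * x = x → (p : M) * e = p
  then h.choose else ⟨0, IsStarProjection.zero M⟩

open Classical in
/-- The right support: the smallest projection `p` with `x p = x`. -/
noncomputable def rightSupport (x : M) : Proj M :=
  if h : ∃ p : Proj M, x * (p : M) = x ∧ ∀ e : Proj M, x * (e : M) = x → (p : M) * e = p
  then h.choose else ⟨0, IsStarProjection.zero M⟩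

/-- The absolute value `|x| = (x⋆x)^{1/2}`. -/
noncomputable def absVal (x : M) : M := cfc Real.sqrt (star x * x)

/-- `b` is the inverse of `a` in the algebra `p M p` with unit `p`. -/
def IsCornerInverse (p : Proj M) (a b : M) : Prop :=
  a ∈ corner (p : M) (p : M) ∧ b ∈ corner (p : M) (p : M) ∧ a * b = p ∧ b * a = p

/-- The set of partially invertible elements: `|x|` is invertible in `p M p`, where `p` is the
support of `|x|`. -/
def partiallyInvertible (M : Type u) [CStarAlgebra M] : Set M :=
  {x | ∃ b, IsCornerInverse (rightSupport (absVal x)) (absVal x) b}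

open Classical in
/-- The inverse `|x|⁻¹` of `|x|` in `p M p`, `p` being the support of `|x|`. -/
noncomputable def absInv (x : M) : M :=
  if h : ∃ b, IsCornerInverse (rightSupport (absVal x)) (absVal x) b then h.choose else 0

/-- The partial isometry `u = x |x|⁻¹` in the polar decomposition `x = u |x|` of a partially
invertible element. -/
noncomputable def polarPart (x : M) : M := x * absInv x

/-- The inversion `ι(x) = |x|⁻¹ u⋆` of the groupoid of partially invertible elements. -/
noncomputable def inversion (x : M) : M := absInv x * star (polarPart x)

/-- The involution `J(x) = ι(x)⋆`. -/
noncomputable def involutionJ (x : M) : M := star (inversion x)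

/-- Equivalence of projections: there is a partially invertible `x` with target `q` and
source `p`. -/
def ProjEquiv (q p : Proj M) : Prop :=
  ∃ x ∈ partiallyInvertible M, leftSupport x = q ∧ rightSupport x = p

/-- `Π_p`: the projections `q` with `M = q M ⊕ (1 - p) M`. -/
def nearProj (p : Proj M) : Set (Proj M) :=
  {q | IsCompl (corner (q : M) 1) (corner (1 - (p : M)) 1)}

open Classical in
/-- The coordinate `φ_p(q) = y` of `q ∈ Π_p`: the component `y ∈ (1 - p) M p` in the decomposition
`p = x - y` with `x ∈ q M p`. -/
noncomputable def projCoord (p q : Proj M) : corner (1 - (p : M)) (p : M) :=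
  if h : ∃ y : corner (1 - (p : M)) (p : M), (q : M) * ((p : M) + y) = p + y
  then h.choose else 0

/-- The element `σ_p(q) = x ∈ q M p` of the same decomposition. -/
noncomputable def projSection (p q : Proj M) : M := p + projCoord p q

/-- `Ω_{q p}`: the partially invertible elements with target in `Π_q` and source in `Π_p`. -/
def chartDomain (q p : Proj M) : Set (partiallyInvertible M) :=
  {x | leftSupport (x : M) ∈ nearProj q ∧ rightSupport (x : M) ∈ nearProj p}

/-- The chart `ψ_{q p} : Ω_{q p} → (1 - q) M q ⊕ q M p ⊕ (1 - p) M p`,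
`x ↦ (φ_q(t(x)), ι(σ_q(t(x))) x σ_p(s(x)), φ_p(s(x)))`. The middle entry lies in `q M p` already,
so that the compression does not change it. -/
noncomputable def groupoidChart (q p : Proj M) : CoordMap ℂ (partiallyInvertible M) where
  Model := corner (1 - (q : M)) (q : M) × corner (q : M) (p : M) × corner (1 - (p : M)) (p : M)
  source := chartDomain q p
  toFun x :=
    (projCoord q (leftSupport (x : M)),
      compress q p (inversion (projSection q (leftSupport (x : M))) * (x : M) *
        projSection p (rightSupport (x : M))),
      projCoord p (rightSupport (x : M)))

/-- The atlas of the groupoid of partially invertible elements, indexed by the pairs of equivalent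
projections. -/
def groupoidAtlas (M : Type u) [CStarAlgebra M] : Set (CoordMap ℂ (partiallyInvertible M)) :=
  {c | ∃ q p : Proj M, ProjEquiv q p ∧ c = groupoidChart q p}

/-- The partial isometries as a subset of the groupoid of partially invertible elements. -/
def unitaryPart (M : Type u) [CStarAlgebra M] : Set (partiallyInvertible M) :=
  {x | (x : M) ∈ partialIsometries M}

/-- The real Banach space `(1 - q) M q ⊕ p Mʰ p ⊕ (1 - p) M p`. -/
abbrev UnitaryModel (q p : Proj M) : Type u :=
  corner (1 - (q : M)) (q : M) × hermCorner p × corner (1 - (p : M)) (p : M)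

/-- The partially invertible elements with target `q` and source `p`. -/
def arrows (q p : Proj M) : Set M :=
  {x | x ∈ partiallyInvertible M ∧ leftSupport x = q ∧ rightSupport x = p}

/-- The structure of a complex manifold on `arrows q p` as an (open) subset of `q M p`: one chart,
the inclusion. -/
noncomputable def arrowsChart (q p : Proj M) : CoordMap ℂ (arrows q p) where
  Model := corner (q : M) (p : M)
  source := Set.univ
  toFun x := compress q p (x : M)

end WStarGroupoid

/-!
The partially invertible elements are exactly the elements `x` with a Moore–Penrose inverse `y`;
then `ι(x) = y`, the left support is `x y` and the right support is `y x`
(`isArrow_of_mem`, `IsArrow.mem_partiallyInvertible`). Everything about the groupoid becomes algebra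
with such pairs: they compose, can be inverted, and are preserved by the adjoint, and `J(x) = y⋆`
fixes `x` exactly when `y = x⋆`, that is, when `x` is a partial isometry.

A projection `q` lies in `Π_p` if and only if there is an idempotent `s` with range `q M` and
kernel `(1 - p) M` (`mem_nearProj_iff`). This `s` is `σ_p(q)`, it is an arrow from `p` to `q`, and
its inverse is simply `p q`. Conversely `p + y` is an arrow with source `p` for every
`y ∈ (1 - p) M p` (`isArrow_graph`). Hence the chart is `x ↦ (σ_q(l(x)) - q, q x σ_p(r(x)),
σ_p(r(x)) - p)`, its inverse sends `(y', z, y)` to `(q + y') z ι(p + y)`, and its image consists of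
the triples whose middle entry is an arrow from `p` to `q`. Although `ι(p + y)` involves `y⋆`, the
adjoint cancels in the changes of charts (`chartPoint_mem_chartDomain`), which are composed of
products and of inversions between fixed supports. The latter are holomorphic, on an open set,
because near an arrow `z` with inverse `t` one has `ι(x) = (1 + t (x - z))⁻¹ t`
(`IsArrow.of_isUnit`). The maps `x ↦ x` and `x ↦ ι(x)` to `M` are continuous in the charts, so that
the topology is Hausdorff and the fixed point set of `J` is closed.

The partial isometries are straightened by a general device (`exists_straightening_chart`). Let
`H` be an analytic function of the coordinates, with invertible derivative at a fixed point of the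
involution `J`, such that `H ∘ J = K ∘ H` for some map `K` of the target. By the analytic inverse
function theorem `H` is a chart near this point, and there the fixed points of `J` are those whose
coordinate is fixed by `K`. Here `J` keeps the outer coordinates and sends the middle one, `z`, to
some `ẑ`; one takes the middle coordinate `h = i (k z - (k ẑ)⋆) / 2`, which `J` turns into `h⋆`.
At a fixed point, for a suitable arrow `k` from `q` to `p`, the two terms have the same derivative
in `z`, so that `∂h/∂z = i k` is invertible (`hasDerivAt_straightMiddle`). The fixed points
correspond to self-adjoint `h`, which gives the model `(1 - q) M q ⊕ p Mʰ p ⊕ (1 - p) M p`.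
On the arrows between two fixed projections the same function is holomorphic, as the outer
coordinates are absent, and exhibits the complexification (`isComplexificationOf_arrowsChart`).
-/

namespace BanachManifold

open Filter Topology

/-! ### Atlases and local transitions -/

section Atlas

variable {𝕜 : Type} [NontriviallyNormedField 𝕜] {X : Type u}

/-- The pointwise form of analytic compatibility: near `c x`, the coordinates of `c` are taken on
points of both domains, and the change to the coordinates of `d` is a map analytic at `c x`. -/
def CoordMap.TransitionAt (c d : CoordMap 𝕜 X) (x : X) : Prop :=
  ∃ τ : c.Model → d.Model, AnalyticAt 𝕜 τ (c.toFun x) ∧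
    ∀ᶠ v in 𝓝 (c.toFun x), ∃ y ∈ c.source ∩ d.source, c.toFun y = v ∧ d.toFun y = τ v

theorem CoordMap.TransitionAt.trans {c e d : CoordMap 𝕜 X} {x : X}
    (he : Set.InjOn e.toFun e.source) (hx : x ∈ c.source ∩ e.source)
    (h₁ : c.TransitionAt e x) (h₂ : e.TransitionAt d x) (hc : Set.InjOn c.toFun c.source) :
    c.TransitionAt d x := by
  obtain ⟨τ₁, a₁, f₁⟩ := h₁
  obtain ⟨τ₂, a₂, f₂⟩ := h₂
  have hτ : τ₁ (c.toFun x) = e.toFun x := by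
    obtain ⟨y, hy, hcy, hey⟩ := f₁.self_of_nhds
    rw [← hey, hc hy.1 hx.1 hcy]
  rw [← hτ] at a₂ f₂
  refine ⟨τ₂ ∘ τ₁, a₂.comp a₁, ?_⟩
  filter_upwards [f₁, a₁.continuousAt.eventually f₂] with v ⟨y, hy, hcy, hey⟩ ⟨y', hy', hey', hdy'⟩
  obtain rfl : y = y' := he hy.2 hy'.1 (hey.trans hey'.symm)
  exact ⟨y, ⟨hy.1, hy'.2⟩, hcy, hdy'⟩

theorem CoordMap.AnalyticTransition.transitionAt {c d : CoordMap 𝕜 X}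
    (h : c.AnalyticTransition d) {x : X} (hx : x ∈ c.source ∩ d.source) :
    c.TransitionAt d x := by
  obtain ⟨ho, τ, hτ, he⟩ := h
  refine ⟨τ, hτ _ ⟨x, hx, rfl⟩, ?_⟩
  filter_upwards [ho.mem_nhds ⟨x, hx, rfl⟩]
  rintro _ ⟨y, hy, rfl⟩
  exact ⟨y, hy, rfl, (he y hy).symm⟩

theorem CoordMap.analyticTransition_of_transitionAt {c d : CoordMap 𝕜 X}
    (hc : Set.InjOn c.toFun c.source)
    (h : ∀ x ∈ c.source ∩ d.source, c.TransitionAt d x) : c.AnalyticTransition d := by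
  have key : ∀ x ∈ c.source ∩ d.source, c.toFun '' (c.source ∩ d.source) ∈ 𝓝 (c.toFun x) := by
    intro x hx
    obtain ⟨τ, -, f⟩ := h x hx
    filter_upwards [f] with v ⟨y, hy, hv, _⟩ using ⟨y, hy, hv⟩
  refine ⟨isOpen_iff_mem_nhds.2 (by rintro _ ⟨x, hx, rfl⟩; exact key x hx), ?_⟩
  classical
  refine ⟨fun v => if hv : ∃ y ∈ c.source ∩ d.source, c.toFun y = v then d.toFun hv.choose else 0,
    ?_, ?_⟩
  · rintro _ ⟨x, hx, rfl⟩
    obtain ⟨τ, hτ, f⟩ := h x hx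
    refine hτ.congr ?_
    filter_upwards [f] with v ⟨y, hy, hcy, hdy⟩
    have hv : ∃ y ∈ c.source ∩ d.source, c.toFun y = v := ⟨y, hy, hcy⟩
    rw [dif_pos hv, ← hdy]
    congr 1
    exact hc hy.1 hv.choose_spec.1.1 (hcy.trans hv.choose_spec.2.symm)
  · intro x hx
    have hv : ∃ y ∈ c.source ∩ d.source, c.toFun y = c.toFun x := ⟨x, hx, rfl⟩
    change dite _ _ _ = _
    rw [dif_pos hv]
    congr 1
    exact hc hv.choose_spec.1.1 hx.1 hv.choose_spec.2

theorem CoordMap.isChart_of_transitionAt {c : CoordMap 𝕜 X}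
    (hc : Set.InjOn c.toFun c.source) (h : ∀ x ∈ c.source, c.TransitionAt c x) : c.IsChart := by
  refine ⟨hc, ?_⟩
  have := (CoordMap.analyticTransition_of_transitionAt hc (fun x hx => h x hx.1)).1
  rwa [Set.inter_self] at this

/-- A map which is continuous in the coordinates of every chart is continuous. -/
theorem continuous_atlasTopology {Z : Type*} [TopologicalSpace Z] {A : Set (CoordMap 𝕜 X)}
    (hcov : ∀ x : X, ∃ c ∈ A, x ∈ c.source) {f : X → Z}
    (hf : ∀ c ∈ A, ∀ x ∈ c.source, ∃ g : c.Model → Z, ContinuousAt g (c.toFun x) ∧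
      ∀ y ∈ c.source, g (c.toFun y) = f y) :
    @Continuous X Z (atlasTopology A) _ f := by
  let _ := atlasTopology A
  refine continuous_iff_continuousAt.2 fun x => ?_
  obtain ⟨c, hc, hx⟩ := hcov x
  obtain ⟨g, hg, hgf⟩ := hf c hc x hx
  intro N hN
  rw [← hgf x hx] at hN
  obtain ⟨V, hVN, hV, hxV⟩ := mem_nhds_iff.1 (hg hN)
  refine mem_nhds_iff.2 ⟨c.source ∩ c.toFun ⁻¹' V, ?_,
    TopologicalSpace.isOpen_generateFrom_of_mem ⟨c, hc, V, hV, rfl⟩, hx, hxV⟩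
  rintro y ⟨hy, hyV⟩
  change f y ∈ N
  rw [← hgf y hy]
  exact hVN hyV

theorem transitionAt_of_mem_maximalAtlas {A : Set (CoordMap 𝕜 X)} (hA : IsBanachAtlas A)
    {c d : CoordMap 𝕜 X} (hc : c ∈ maximalAtlas A) (hd : d ∈ maximalAtlas A) {x : X}
    (hx : x ∈ c.source ∩ d.source) : c.TransitionAt d x := by
  obtain ⟨e, he, hxe⟩ := hA.covers x
  exact ((hc.2 e he).1.transitionAt ⟨hx.1, hxe⟩).trans (hA.isChart e he).1 ⟨hx.1, hxe⟩
    ((hd.2 e he).2.transitionAt ⟨hxe, hx.2⟩) hc.1.1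

theorem subset_maximalAtlas {A : Set (CoordMap 𝕜 X)} (hA : IsBanachAtlas A) :
    A ⊆ maximalAtlas A :=
  fun c hc => ⟨hA.isChart c hc, fun d hd => ⟨hA.compatible c hc d hd, hA.compatible d hd c hc⟩⟩

/-- A new coordinate map compatible, at each point of its domain, with a chart `c₀` of the maximal
atlas belongs to the maximal atlas. -/
theorem mem_maximalAtlas_of_transitionAt {A : Set (CoordMap 𝕜 X)} (hA : IsBanachAtlas A)
    {c c₀ : CoordMap 𝕜 X} (hc₀ : c₀ ∈ maximalAtlas A) (hs : c.source ⊆ c₀.source)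
    (hc : Set.InjOn c.toFun c.source)
    (h : ∀ x ∈ c.source, c.TransitionAt c₀ x ∧ c₀.TransitionAt c x) : c ∈ maximalAtlas A := by
  refine ⟨CoordMap.isChart_of_transitionAt hc fun x hx =>
    (h x hx).1.trans hc₀.1.1 ⟨hx, hs hx⟩ (h x hx).2 hc, fun d hd => ⟨?_, ?_⟩⟩
  · refine CoordMap.analyticTransition_of_transitionAt hc fun x hx => ?_
    exact (h x hx.1).1.trans hc₀.1.1 ⟨hx.1, hs hx.1⟩
      ((hc₀.2 d hd).1.transitionAt ⟨hs hx.1, hx.2⟩) hc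
  · refine CoordMap.analyticTransition_of_transitionAt (hA.isChart d hd).1 fun x hx => ?_
    exact ((hc₀.2 d hd).2.transitionAt ⟨hx.1, hs hx.2⟩).trans hc₀.1.1 ⟨hx.1, hs hx.2⟩
      (h x hx.2).2 (hA.isChart d hd).1

end Atlas

/-! ### Induced charts on a subset -/

section Induced

variable {𝕜 : Type} [NontriviallyNormedField 𝕜] {X : Type u}

theorem exists_leftInverse_of_closedComplemented {E F : Type*} [NormedAddCommGroup E]
    [NormedSpace 𝕜 E] [CompleteSpace E] [NormedAddCommGroup F] [NormedSpace 𝕜 F] [CompleteSpace F]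
    (j : E →L[𝕜] F) (hj : Function.Injective j) (hcl : IsClosed (Set.range j))
    (hc : (LinearMap.range j.toLinearMap).ClosedComplemented) :
    ∃ P : F →L[𝕜] E, ∀ v, P (j v) = v := by
  obtain ⟨f, hf⟩ := hc
  refine ⟨((j.equivRange hj hcl).symm : _ →L[𝕜] E).comp f, fun v => ?_⟩
  have h : f (j v) = ⟨j v, LinearMap.mem_range_self j.toLinearMap v⟩ := hf ⟨j v, _⟩
  rw [ContinuousLinearMap.comp_apply, h]
  exact (j.equivRange hj hcl).symm_apply_apply v

/-- A chart `d` induced on `Y` from `c`: near `d y`, the transition to any other induced chart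
`d'` is the transition of the ambient charts followed by a linear projection onto the model of
`d'`. -/
theorem transitionAt_of_mem_inducedCharts {A : Set (CoordMap 𝕜 X)} (hA : IsBanachAtlas A)
    {Y : Set X} {d d' : CoordMap 𝕜 Y} (hd : d ∈ inducedCharts A Y) (hd' : d' ∈ inducedCharts A Y)
    {y : Y} (hy : y ∈ d.source ∩ d'.source) : d.TransitionAt d' y := by
  obtain ⟨c, hc, j, hj, -, -, hs, hjc, himg⟩ := hd
  obtain ⟨c', hc', j', hj', hcl', hcc', hs', hjc', -⟩ := hd'
  obtain ⟨P, hP⟩ := exists_leftInverse_of_closedComplemented j' hj' hcl' hcc'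
  have hyc : (y : X) ∈ c.source ∩ c'.source := by
    have h₁ := hy.1
    have h₂ := hy.2
    rw [hs] at h₁
    rw [hs'] at h₂
    exact ⟨h₁, h₂⟩
  obtain ⟨τ, hτ, f⟩ := transitionAt_of_mem_maximalAtlas hA hc hc' hyc
  rw [← hjc y hy.1] at hτ f
  refine ⟨P ∘ τ ∘ j, (P.analyticAt _).comp (hτ.comp (j.analyticAt _)), ?_⟩
  filter_upwards [j.continuous.continuousAt.eventually f] with v ⟨x, hx, hcx, hτx⟩
  obtain ⟨x', ⟨hx'c, hx'Y⟩, hx'⟩ : j v ∈ c.toFun '' (c.source ∩ Y) := by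
    rw [himg]
    exact ⟨⟨x, hx.1, hcx⟩, ⟨v, rfl⟩⟩
  obtain rfl : x = x' := hc.1.1 hx.1 hx'c (hcx.trans hx'.symm)
  have h₁ : (⟨x, hx'Y⟩ : Y) ∈ d.source := by rw [hs]; exact hx.1
  have h₂ : (⟨x, hx'Y⟩ : Y) ∈ d'.source := by rw [hs']; exact hx.2
  refine ⟨⟨x, hx'Y⟩, ⟨h₁, h₂⟩, hj ((hjc _ h₁).trans hcx), ?_⟩
  rw [Function.comp_apply, Function.comp_apply, ← hτx, ← hjc' _ h₂, hP]

theorem injOn_of_mem_inducedCharts {A : Set (CoordMap 𝕜 X)} {Y : Set X} {d : CoordMap 𝕜 Y}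
    (hd : d ∈ inducedCharts A Y) : Set.InjOn d.toFun d.source := by
  obtain ⟨c, hc, j, hj, -, -, hs, hjc, -⟩ := hd
  intro y hy y' hy' h
  refine Subtype.ext (hc.1.1 ?_ ?_ ?_)
  · rw [hs] at hy; exact hy
  · rw [hs] at hy'; exact hy'
  · rw [← hjc y hy, ← hjc y' hy', h]

/-- The inclusion of a submanifold is continuous for the topology given by induced charts. -/
theorem continuous_val_of_subset_inducedCharts {A : Set (CoordMap 𝕜 X)} (hA : IsBanachAtlas A)
    {Y : Set X} {B : Set (CoordMap 𝕜 Y)} (hB : B ⊆ inducedCharts A Y)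
    (hcov : ∀ y : Y, ∃ d ∈ B, y ∈ d.source) :
    @Continuous Y X (atlasTopology B) (atlasTopology A) Subtype.val := by
  let _ := atlasTopology B
  refine continuous_generateFrom_iff.2 ?_
  rintro _ ⟨c', hc', V, hV, rfl⟩
  refine isOpen_iff_mem_nhds.2 fun y hy => ?_
  obtain ⟨d, hd, hyd⟩ := hcov y
  obtain ⟨c, hc, j, hj, -, -, hs, hjc, himg⟩ := hB hd
  have hyc : (y : X) ∈ c.source := by rw [hs] at hyd; exact hyd
  obtain ⟨τ, hτ, f⟩ := transitionAt_of_mem_maximalAtlas hA hc (subset_maximalAtlas hA hc')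
    ⟨hyc, hy.1⟩
  have hτy : τ (c.toFun y) ∈ V := by
    obtain ⟨x, hx, hcx, hτx⟩ := f.self_of_nhds
    obtain h : x = y := hc.1.1 hx.1 hyc hcx
    rw [← hτx, h]
    exact hy.2
  have hev := f.and (hτ.continuousAt.eventually (hV.mem_nhds hτy))
  rw [← hjc y hyd] at hev
  obtain ⟨O, hO, hOo, hyO⟩ := eventually_nhds_iff.1 (j.continuous.continuousAt.eventually hev)
  refine mem_nhds_iff.2 ⟨d.source ∩ d.toFun ⁻¹' O, ?_,
    TopologicalSpace.isOpen_generateFrom_of_mem ⟨d, hd, O, hOo, rfl⟩, hyd, hyO⟩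
  rintro y' ⟨hy'd, hy'O⟩
  obtain ⟨⟨x, hx, hcx, hτx⟩, hV'⟩ := hO _ hy'O
  have hy'c : (y' : X) ∈ c.source := by rw [hs] at hy'd; exact hy'd
  obtain h : x = y' := hc.1.1 hx.1 hy'c (hcx.trans (hjc y' hy'd))
  rw [← hτx, h] at hV'
  rw [h] at hx
  exact ⟨hx.2, hV'⟩

/-- Any set of induced charts which covers a submanifold is an atlas on it. -/
theorem isBanachAtlas_of_subset_inducedCharts {A : Set (CoordMap 𝕜 X)} (hA : IsBanachAtlas A)
    {Y : Set X} {B : Set (CoordMap 𝕜 Y)} (hB : B ⊆ inducedCharts A Y)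
    (hcov : ∀ y : Y, ∃ d ∈ B, y ∈ d.source) : IsBanachAtlas B where
  covers := hcov
  isChart d hd := CoordMap.isChart_of_transitionAt (injOn_of_mem_inducedCharts (hB hd))
    fun _ hy => transitionAt_of_mem_inducedCharts hA (hB hd) (hB hd) ⟨hy, hy⟩
  compatible d hd d' hd' := CoordMap.analyticTransition_of_transitionAt
    (injOn_of_mem_inducedCharts (hB hd))
    fun _ hy => transitionAt_of_mem_inducedCharts hA (hB hd) (hB hd') hy
  hausdorff := by
    let _ := atlasTopology A
    have := hA.hausdorff
    exact @T2Space.of_injective_continuous _ _ (atlasTopology B) _ _ _ Subtype.val_injective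
      (continuous_val_of_subset_inducedCharts hA hB hcov)

end Induced

/-! ### Straightening the fixed points of an involution -/

section Straighten

variable {𝕜 : Type} [RCLike 𝕜] {X : Type u}

/-- The analytic inverse function theorem, with the inverse analytic on a whole neighbourhood. -/
theorem exists_analytic_localInverse {E F : Type*} [NormedAddCommGroup E] [NormedSpace 𝕜 E]
    [CompleteSpace E] [NormedAddCommGroup F] [NormedSpace 𝕜 F] [CompleteSpace F] {H : E → F}
    {e : E} (hH : AnalyticAt 𝕜 H e) (D : E ≃L[𝕜] F) (hD : HasFDerivAt H (D : E →L[𝕜] F) e) :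
    ∃ (W : Set E) (G : F → E), IsOpen W ∧ e ∈ W ∧ (∀ v ∈ W, AnalyticAt 𝕜 H v) ∧
      (∀ v ∈ W, AnalyticAt 𝕜 G (H v)) ∧ (∀ v ∈ W, G (H v) = v) ∧
      ∀ v ∈ W, ∀ᶠ w in 𝓝 (H v), H (G w) = w := by
  have hs : HasStrictFDerivAt H (D : E →L[𝕜] F) e := by
    have := hH.hasStrictFDerivAt
    rwa [hD.fderiv] at this
  set Φ := hs.toOpenPartialHomeomorph H with hΦ
  have hcoe : (Φ : E → F) = H := hs.toOpenPartialHomeomorph_coe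
  have he : e ∈ Φ.source := hs.mem_toOpenPartialHomeomorph_source
  have hsymm : AnalyticAt 𝕜 Φ.symm (H e) := by
    have hG : Φ.symm (H e) = e := by
      rw [← hcoe]
      exact Φ.left_inv he
    refine ContDiffAt.analyticAt (Φ.contDiffAt_symm (f₀' := D) ?_ ?_ ?_)
    · rw [← hcoe]
      exact Φ.map_source he
    · rw [hG, hcoe]
      exact hD
    · rw [hG, hcoe]
      exact hH.contDiffAt
  refine ⟨Φ.source ∩ H ⁻¹' {w | AnalyticAt 𝕜 Φ.symm w} ∩ {v | AnalyticAt 𝕜 H v}, Φ.symm,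
    ?_, ⟨⟨he, hsymm⟩, hH⟩, fun v hv => hv.2, fun v hv => hv.1.2, fun v hv => ?_, fun v hv => ?_⟩
  · refine IsOpen.inter ?_ (isOpen_analyticAt 𝕜 H)
    have := Φ.isOpen_inter_preimage (isOpen_analyticAt 𝕜 Φ.symm)
    rwa [hcoe] at this
  · rw [← hcoe]
    exact Φ.left_inv hv.1.1
  · have : H v ∈ Φ.target := by
      rw [← hcoe]
      exact Φ.map_source hv.1.1
    filter_upwards [Φ.open_target.mem_nhds this] with w hw
    have := Φ.right_inv hw
    rwa [hcoe] at this

/-- The fixed points of an involution `J` are straightened by any analytic function `H` of the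
coordinates which intertwines `J` with a map `K` of the target and has an invertible derivative:
after shrinking to a `J`-invariant neighbourhood on which `H` is injective, a point `x` is fixed by
`J` if and only if `K` fixes its new coordinate, since `J x` has the coordinate `K (H x)`. -/
theorem exists_straightening_chart {A : Set (CoordMap 𝕜 X)} (hA : IsBanachAtlas A)
    {c : CoordMap 𝕜 X} (hc : c ∈ maximalAtlas A) {E : Type u} [NormedAddCommGroup E]
    [NormedSpace 𝕜 E] [CompleteSpace E] {Y : Set X} {J : X → X} {Jc : c.Model → c.Model}
    {H : c.Model → E} {K : E → E} {x : X} (hx : x ∈ c.source) (hxJ : J x = x)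
    (hJs : ∀ y ∈ c.source, J y ∈ c.source) (hJJ : ∀ y, J (J y) = y)
    (hJY : ∀ y, y ∈ Y ↔ J y = y)
    (hJc : ∀ y ∈ c.source, Jc (c.toFun y) = c.toFun (J y))
    (hJcont : ∀ y ∈ c.source, ContinuousAt Jc (c.toFun y))
    (hK : ∀ y ∈ c.source, H (c.toFun (J y)) = K (H (c.toFun y)))
    (hH : AnalyticAt 𝕜 H (c.toFun x)) (D : c.Model ≃L[𝕜] E)
    (hD : HasFDerivAt H (D : c.Model →L[𝕜] E) (c.toFun x)) :
    ∃ S ⊆ c.source, x ∈ S ∧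
      ({ Model := E, source := S, toFun := fun y => H (c.toFun y) } : CoordMap 𝕜 X)
        ∈ maximalAtlas A ∧
      (fun y => H (c.toFun y)) '' (S ∩ Y) = (fun y => H (c.toFun y)) '' S ∩ {e | K e = e} := by
  obtain ⟨W, G, hW, hxW, hHan, hGan, hGH, hHG⟩ := exists_analytic_localInverse hH D hD
  -- the domain: points of `W` which `J` sends into `W`
  set S : Set X := {y | y ∈ c.source ∧ c.toFun y ∈ W ∧ c.toFun (J y) ∈ W} with hS
  have hSnhds : ∀ y ∈ S, ∀ᶠ v in 𝓝 (c.toFun y), ∃ y' ∈ S, c.toFun y' = v := by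
    intro y hy
    have h₂ : Jc (c.toFun y) ∈ W := by
      rw [hJc y hy.1]
      exact hy.2.2
    filter_upwards [hc.1.2.mem_nhds ⟨y, hy.1, rfl⟩, hW.mem_nhds hy.2.1,
      (hJcont y hy.1).eventually (hW.mem_nhds h₂)]
    rintro _ ⟨y', hy', rfl⟩ hW' hJ'
    rw [hJc y' hy'] at hJ'
    exact ⟨y', ⟨hy', hW', hJ'⟩, rfl⟩
  have hinj : Set.InjOn (fun y => H (c.toFun y)) S := by
    intro y hy y' hy' h
    refine hc.1.1 hy.1 hy'.1 ?_
    rw [← hGH _ hy.2.1, ← hGH _ hy'.2.1]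
    exact congrArg G h
  refine ⟨S, fun y hy => hy.1, ⟨hx, hxW, ?_⟩, ?_, ?_⟩
  · rw [hxJ]
    exact hxW
  · refine mem_maximalAtlas_of_transitionAt hA hc (fun y hy => hy.1) hinj fun y hy => ⟨?_, ?_⟩
    · refine ⟨G, hGan _ hy.2.1, ?_⟩
      have h := (hGan _ hy.2.1).continuousAt.tendsto
      rw [hGH _ hy.2.1] at h
      filter_upwards [hHG _ hy.2.1, h.eventually (hSnhds y hy)]
      rintro w hw ⟨y', hy', hcy'⟩
      refine ⟨y', ⟨hy', hy'.1⟩, ?_, hcy'⟩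
      rw [hcy', hw]
    · refine ⟨H, hHan _ hy.2.1, ?_⟩
      filter_upwards [hSnhds y hy]
      rintro _ ⟨y', hy', rfl⟩
      exact ⟨y', ⟨hy'.1, hy'⟩, rfl, rfl⟩
  · ext w
    constructor
    · rintro ⟨y, ⟨hy, hyY⟩, rfl⟩
      refine ⟨⟨y, hy, rfl⟩, ?_⟩
      change K (H (c.toFun y)) = H (c.toFun y)
      rw [← hK y hy.1, (hJY y).1 hyY]
    · rintro ⟨⟨y, hy, rfl⟩, hw⟩
      refine ⟨y, ⟨hy, (hJY y).2 ?_⟩, rfl⟩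
      have hJy : J y ∈ S := ⟨hJs y hy.1, hy.2.2, by rw [hJJ]; exact hy.2.1⟩
      refine hinj hJy hy ?_
      change H (c.toFun (J y)) = H (c.toFun y)
      rw [hK y hy.1]
      exact hw

end Straighten

/-! ### The underlying real manifold -/

section Real

variable {X : Type u}

theorem CoordMap.AnalyticTransition.toReal {c d : CoordMap ℂ X} (h : c.AnalyticTransition d) :
    c.toReal.AnalyticTransition d.toReal := by
  obtain ⟨ho, τ, hτ, he⟩ := h
  exact ⟨ho, τ, fun v hv =>
    @AnalyticAt.restrictScalars ℝ _ c.Model d.Model _ NormedSpace.complexToReal _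
      NormedSpace.complexToReal ℂ _ _ _ inferInstance _ inferInstance τ v (hτ v hv), he⟩

theorem atlasTopology_realAtlas (A : Set (CoordMap ℂ X)) :
    atlasTopology (realAtlas A) = atlasTopology A := by
  unfold atlasTopology
  congr 1
  ext W
  constructor
  · rintro ⟨_, ⟨c, hc, rfl⟩, V, hV, rfl⟩
    exact ⟨c, hc, V, hV, rfl⟩
  · rintro ⟨c, hc, V, hV, rfl⟩
    exact ⟨c.toReal, ⟨c, hc, rfl⟩, V, hV, rfl⟩

theorem IsBanachAtlas.realAtlas {A : Set (CoordMap ℂ X)} (hA : IsBanachAtlas A) :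
    IsBanachAtlas (realAtlas A) where
  covers x := by
    obtain ⟨c, hc, hx⟩ := hA.covers x
    exact ⟨c.toReal, ⟨c, hc, rfl⟩, hx⟩
  isChart := by
    rintro _ ⟨c, hc, rfl⟩
    exact hA.isChart c hc
  compatible := by
    rintro _ ⟨c, hc, rfl⟩ _ ⟨d, hd, rfl⟩
    exact (hA.compatible c hc d hd).toReal
  hausdorff := by
    rw [atlasTopology_realAtlas]
    exact hA.hausdorff

end Real

end BanachManifold

namespace WStarGroupoid

open BanachManifold Filter Topology

variable {M : Type u} [CStarAlgebra M]

/-! ### Partially invertible elements and generalized inverses -/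

/-- `x` is an arrow from the projection `p` to the projection `q` with inverse `y`: `y` is the
Moore–Penrose inverse of `x`, and `q = x y`, `p = y x`. -/
structure IsArrow (q p x y : M) : Prop where
  mul_inv : x * y = q
  inv_mul : y * x = p
  target_mul : q * x = x
  source_mul : p * y = y
  star_target : star q = q
  star_source : star p = p

namespace IsArrow

variable {q p r x y z w : M}

theorem mul_source (h : IsArrow q p x y) : x * p = x := by
  rw [← h.inv_mul, ← mul_assoc, h.mul_inv, h.target_mul]

theorem mul_target (h : IsArrow q p x y) : y * q = y := by
  rw [← h.mul_inv, ← mul_assoc, h.inv_mul, h.source_mul]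

theorem symm (h : IsArrow q p x y) : IsArrow p q y x :=
  ⟨h.inv_mul, h.mul_inv, h.source_mul, h.target_mul, h.star_source, h.star_target⟩

theorem adjoint (h : IsArrow q p x y) : IsArrow p q (star x) (star y) where
  mul_inv := by rw [← star_mul, h.inv_mul, h.star_source]
  inv_mul := by rw [← star_mul, h.mul_inv, h.star_target]
  target_mul := by
    conv_lhs => rw [← h.star_source]
    rw [← star_mul, h.mul_source]
  source_mul := by
    conv_lhs => rw [← h.star_target]
    rw [← star_mul, h.mul_target]
  star_target := h.star_source
  star_source := h.star_target

theorem comp (h : IsArrow q p x y) (h' : IsArrow p r z w) : IsArrow q r (x * z) (w * y) where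
  mul_inv := by rw [mul_assoc, ← mul_assoc z, h'.mul_inv, h.source_mul, h.mul_inv]
  inv_mul := by rw [mul_assoc, ← mul_assoc y, h.inv_mul, h'.target_mul, h'.inv_mul]
  target_mul := by rw [← mul_assoc, h.target_mul]
  source_mul := by rw [← mul_assoc, h'.source_mul]
  star_target := h.star_target
  star_source := h'.star_source

theorem target_idem (h : IsArrow q p x y) : q * q = q := by
  conv_lhs => rw [← h.mul_inv]
  rw [mul_assoc, ← mul_assoc y, h.inv_mul, h.source_mul, h.mul_inv]

theorem isStarProjection_target (h : IsArrow q p x y) : IsStarProjection q :=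
  ⟨h.target_idem, h.star_target⟩

theorem refl (hp : IsStarProjection p) : IsArrow p p p p :=
  ⟨hp.1, hp.1, hp.1, hp.1, hp.2, hp.2⟩

/-- The Moore–Penrose inverse is unique. -/
theorem unique {q' p' : M} (h : IsArrow q p x y) (h' : IsArrow q' p' x z) :
    q = q' ∧ p = p' ∧ y = z := by
  have hq : q = q' := by
    have e₁ : q * q' = q' := by rw [← h'.mul_inv, ← mul_assoc, h.target_mul]
    have e₂ : q' * q = q := by rw [← h.mul_inv, ← mul_assoc, h'.target_mul]
    rw [← h.star_target, ← e₂, star_mul, h'.star_target, h.star_target, e₁]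
  have hp : p = p' := by
    have e₁ : p * p' = p := by rw [← h.inv_mul, mul_assoc, h'.mul_source]
    have e₂ : p' * p = p' := by rw [← h'.inv_mul, mul_assoc, h.mul_source]
    rw [← h'.star_source, ← e₂, star_mul, h.star_source, h'.star_source, e₁]
  refine ⟨hq, hp, ?_⟩
  rw [← h.mul_target, hq, ← h'.mul_inv, ← mul_assoc, h.inv_mul, hp, h'.source_mul]

end IsArrow

section Supports

variable {q p x y : M}

theorem leftSupport_eq_of {p : Proj M} (hp : (p : M) * x = x)
    (hmin : ∀ e : Proj M, (e : M) * x = x → (p : M) * e = p) : leftSupport x = p := by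
  have h : ∃ p : Proj M, (p : M) * x = x ∧ ∀ e : Proj M, (e : M) * x = x → (p : M) * e = p :=
    ⟨p, hp, hmin⟩
  rw [leftSupport, dif_pos h]
  obtain ⟨h₁, h₂⟩ := h.choose_spec
  refine Subtype.ext ?_
  have e₁ := h₂ p hp
  have e₂ := hmin _ h₁
  calc (h.choose : M) = star ((p : M) * h.choose) := by
        rw [star_mul, h.choose.2.2.star_eq, p.2.2.star_eq, e₁]
    _ = p := by rw [e₂, p.2.2.star_eq]

theorem rightSupport_eq_of {p : Proj M} (hp : x * (p : M) = x)
    (hmin : ∀ e : Proj M, x * (e : M) = x → (p : M) * e = p) : rightSupport x = p := by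
  have h : ∃ p : Proj M, x * (p : M) = x ∧ ∀ e : Proj M, x * (e : M) = x → (p : M) * e = p :=
    ⟨p, hp, hmin⟩
  rw [rightSupport, dif_pos h]
  obtain ⟨h₁, h₂⟩ := h.choose_spec
  refine Subtype.ext ?_
  have e₁ := h₂ p hp
  have e₂ := hmin _ h₁
  calc (h.choose : M) = star ((p : M) * h.choose) := by
        rw [star_mul, h.choose.2.2.star_eq, p.2.2.star_eq, e₁]
    _ = p := by rw [e₂, p.2.2.star_eq]

theorem IsArrow.leftSupport_coe (h : IsArrow q p x y) : (leftSupport x : M) = q := by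
  rw [leftSupport_eq_of (p := ⟨q, h.isStarProjection_target⟩) h.target_mul]
  intro e he
  have : (e : M) * q = q := by rw [← h.mul_inv, ← mul_assoc, he]
  calc q * (e : M) = star ((e : M) * q) := by rw [star_mul, h.star_target, e.2.2.star_eq]
    _ = q := by rw [this, h.star_target]

theorem IsArrow.rightSupport_coe (h : IsArrow q p x y) : (rightSupport x : M) = p := by
  rw [rightSupport_eq_of (p := ⟨p, h.symm.isStarProjection_target⟩) h.mul_source]
  intro e he
  change p * (e : M) = p
  rw [← h.inv_mul, mul_assoc, he]

theorem isSelfAdjoint_absVal (x : M) : star (absVal x) = absVal x :=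
  (cfc_predicate Real.sqrt (star x * x) : IsSelfAdjoint _)

theorem absVal_mul_self (x : M) : absVal x * absVal x = star x * x := by
  have hsa : IsSelfAdjoint (star x * x) := IsSelfAdjoint.star_mul_self x
  unfold absVal
  rw [← cfc_mul Real.sqrt Real.sqrt (star x * x)]
  conv_rhs => rw [← cfc_id ℝ (star x * x) hsa]
  refine cfc_congr fun t ht => ?_
  exact Real.mul_self_sqrt (spectrum_star_mul_self_nonneg t ht)

/-- If `star x * x` annihilates `e` then so does `x`. -/
theorem mul_eq_zero_of_star_mul_self {e : M} (h : star x * x * e = 0) : x * e = 0 := by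
  rw [← CStarRing.star_mul_self_eq_zero_iff, star_mul, mul_assoc, ← mul_assoc (star x), h,
    mul_zero]

theorem mul_eq_self_of_star_mul_self {e : M} (h : star x * x * e = star x * x) : x * e = x := by
  have : x * (1 - e) = 0 := mul_eq_zero_of_star_mul_self (by rw [mul_sub, h, mul_one, sub_self])
  rw [mul_sub, mul_one, sub_eq_zero] at this
  exact this.symm

theorem absVal_mul_eq {e : M} (h : x * e = x) : absVal x * e = absVal x := by
  refine mul_eq_self_of_star_mul_self ?_
  rw [isSelfAdjoint_absVal, absVal_mul_self, mul_assoc, h]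

/-- A partially invertible element is an arrow from its right to its left support, with inverse
`ι(x)`. Only the relations defining a corner inverse enter, which already force `rightSupport` of
`|x|` to be the support rather than the default value `0`. -/
theorem isArrow_of_mem (hx : x ∈ partiallyInvertible M) :
    IsArrow (leftSupport x : M) (rightSupport x) x (inversion x) := by
  have key : ∃ q p, IsArrow q p x (inversion x) := by
    have hx' : ∃ b, IsCornerInverse (rightSupport (absVal x)) (absVal x) b := hx
    have hb : absInv x = hx'.choose := by rw [absInv, dif_pos hx']
    obtain ⟨ha, hbc, hab, hba⟩ := hx'.choose_spec
    rw [← hb] at hbc hab hba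
    set p := rightSupport (absVal x) with hp
    set a := absVal x with hadef
    set b := absInv x with hbdef
    have hpp : (p : M) * p = p := p.2.1
    have hps : star (p : M) = p := p.2.2
    have ha' : (p : M) * a * p = a := ha
    have hb' : (p : M) * b * p = b := hbc
    have hap : a * p = a := by rw [← ha', mul_assoc, hpp]
    have hpb : (p : M) * b = b := by rw [← hb', ← mul_assoc, ← mul_assoc, hpp]
    have hbp : b * p = b := by rw [← hb', mul_assoc, hpp]
    have hsa : star a = a := isSelfAdjoint_absVal x
    have hbs : star b = b := by
      have h₁ : star b * a = p := by rw [← hsa, ← star_mul, hab, hps]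
      have h₂ : star b * p = star b := by
        conv_lhs => rw [← hps]
        rw [← star_mul, hpb]
      rw [← h₂, ← hab, ← mul_assoc, h₁, hpb]
    have hxx : star x * x = a * a := (absVal_mul_self x).symm
    have hxp : x * p = x := by
      refine mul_eq_self_of_star_mul_self ?_
      rw [hxx, mul_assoc, hap]
    have hι : inversion x = b * (b * star x) := by
      unfold inversion polarPart
      rw [← hbdef, star_mul, hbs]
    have e₁ : inversion x * x = p := by
      rw [hι, mul_assoc, mul_assoc, hxx, ← mul_assoc b a a, hba, ← mul_assoc, hbp, hba]
    have e₂ : star (x * inversion x) = x * inversion x := by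
      rw [hι]
      simp only [star_mul, star_star, hbs, mul_assoc]
    refine ⟨x * inversion x, p, rfl, e₁, ?_, ?_, e₂, hps⟩
    · rw [mul_assoc, e₁, hxp]
    · rw [hι, ← mul_assoc, hpb]
  obtain ⟨q, p, h⟩ := key
  rw [h.leftSupport_coe, h.rightSupport_coe]
  exact h

theorem IsArrow.mem_partiallyInvertible (h : IsArrow q p x y) : x ∈ partiallyInvertible M := by
  set a := absVal x with hadef
  have hsa : star a = a := isSelfAdjoint_absVal x
  have haa : a * a = star x * x := absVal_mul_self x
  have hap : a * p = a := absVal_mul_eq h.mul_source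
  have hpa : p * a = a := by
    have := congrArg star hap
    rwa [star_mul, hsa, h.star_source] at this
  -- `y y⋆` inverts `x⋆ x = a²` in the corner of `p`
  have hc := h.adjoint.comp h
  set c := y * star y with hcdef
  rw [← haa] at hc
  have hab : a * (a * c) = p := by rw [← mul_assoc, hc.mul_inv]
  have hcap : c * a * p = c * a := by rw [mul_assoc, hap]
  have hcomm : c * a = a * c := by
    calc c * a = c * a * (a * (a * c)) := by rw [hab, hcap]
      _ = (c * (a * a)) * (a * c) := by simp only [mul_assoc]
      _ = a * c := by rw [hc.inv_mul, ← mul_assoc, hpa]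
  have hba : a * c * a = p := by rw [← hcomm, mul_assoc, hc.inv_mul]
  have harr : IsArrow p p a (a * c) :=
    ⟨hab, hba, hpa, by rw [← mul_assoc, hpa], h.star_source, h.star_source⟩
  refine ⟨a * c, ?_⟩
  have hr := harr.rightSupport_coe
  refine ⟨?_, ?_, ?_, ?_⟩
  · change _ * _ * _ = _
    rw [hr, hpa, hap]
  · change _ * _ * _ = _
    rw [hr, harr.source_mul, harr.mul_target]
  · rw [hr, hab]
  · rw [hr, hba]

theorem IsArrow.inversion_eq (h : IsArrow q p x y) : inversion x = y :=
  ((isArrow_of_mem h.mem_partiallyInvertible).unique h).2.2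

theorem mem_arrows_iff {q p : Proj M} {x : M} :
    x ∈ arrows q p ↔ IsArrow (q : M) p x (inversion x) := by
  constructor
  · rintro ⟨hx, rfl, rfl⟩
    exact isArrow_of_mem hx
  · intro h
    exact ⟨h.mem_partiallyInvertible, Subtype.ext h.leftSupport_coe,
      Subtype.ext h.rightSupport_coe⟩

end Supports

/-! ### Partial isometries and the involution `J` -/

theorem isArrow_involutionJ {x : M} (hx : x ∈ partiallyInvertible M) :
    IsArrow (leftSupport x : M) (rightSupport x) (involutionJ x) (star x) :=
  (isArrow_of_mem hx).symm.adjoint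

theorem involutionJ_mem {x : M} (hx : x ∈ partiallyInvertible M) :
    involutionJ x ∈ partiallyInvertible M :=
  (isArrow_involutionJ hx).mem_partiallyInvertible

theorem involutionJ_involutionJ {x : M} (hx : x ∈ partiallyInvertible M) :
    involutionJ (involutionJ x) = x := by
  rw [involutionJ, (isArrow_involutionJ hx).inversion_eq, star_star]

theorem isArrow_of_mem_partialIsometries {x : M} (hx : x ∈ partialIsometries M) :
    IsArrow (x * star x) (star x * x) x (star x) := by
  have h : IsStarProjection (star x * x) := hx
  have h₁ : x * (star x * x) = x := mul_eq_self_of_star_mul_self h.1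
  refine ⟨rfl, rfl, by rw [mul_assoc, h₁], ?_, by simp, by simp⟩
  have := congrArg star h₁
  simpa [mul_assoc] using this

theorem mem_partialIsometries_iff {x : M} (hx : x ∈ partiallyInvertible M) :
    x ∈ partialIsometries M ↔ involutionJ x = x := by
  constructor
  · intro h
    rw [involutionJ, (isArrow_of_mem_partialIsometries h).inversion_eq, star_star]
  · intro h
    have hi : inversion x = star x := by
      rw [← h, involutionJ, star_star, ← involutionJ, h]
    have h' := isArrow_of_mem hx
    rw [hi] at h'
    have := h'.symm.isStarProjection_target
    rw [← h'.inv_mul] at this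
    exact this

theorem setOf_involutionJ_eq :
    {x ∈ partiallyInvertible M | involutionJ x = x} = partialIsometries M := by
  ext x
  constructor
  · rintro ⟨hx, h⟩
    exact (mem_partialIsometries_iff hx).2 h
  · intro h
    have hx := (isArrow_of_mem_partialIsometries h).mem_partiallyInvertible
    exact ⟨hx, (mem_partialIsometries_iff hx).1 h⟩

/-! ### Oblique idempotents and the coordinates of a projection -/

/-- `s` is the idempotent with range `q M` and kernel `(1 - p) M`. -/
structure IsOblique (p q s : M) : Prop where
  mul_source : s * p = s
  target_mul : q * s = s
  source_mul : p * s = p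
  mul_target : s * q = q

namespace IsOblique

variable {p q s s' : M}

theorem unique_of (h : IsOblique p q s) (h₂ : q * s' = s')
    (h₃ : p * s' = p) : s' = s := by
  have e₁ : s * s' = s' := by
    conv_lhs => rw [← h₂]
    rw [← mul_assoc, h.mul_target, h₂]
  have e₂ : s * s' = s := by
    conv_lhs => rw [← h.mul_source]
    rw [mul_assoc, h₃, h.mul_source]
  exact e₁.symm.trans e₂

/-- The oblique idempotent is an arrow from `p` to `q`, with inverse `p q`. -/
theorem isArrow (h : IsOblique p q s) (hp : IsStarProjection p) (hq : IsStarProjection q) :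
    IsArrow q p s (p * q) where
  mul_inv := by rw [← mul_assoc, h.mul_source, h.mul_target]
  inv_mul := by rw [mul_assoc, h.target_mul, h.source_mul]
  target_mul := h.target_mul
  source_mul := by rw [← mul_assoc, hp.1.eq]
  star_target := hq.2
  star_source := hp.2

theorem sub_mem (h : IsOblique p q s) (hp : IsStarProjection p) :
    s - p ∈ corner (1 - p) p := by
  change (1 - p) * (s - p) * p = s - p
  have hpp : p * p = p := hp.1
  simp only [sub_mul, mul_sub, one_mul, h.source_mul, hpp, sub_self, sub_zero, h.mul_source]

end IsOblique

theorem mem_nearProj_iff {p q : Proj M} :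
    q ∈ nearProj p ↔ ∃ s : M, IsOblique (p : M) q s := by
  have hpp : (p : M) * p = p := p.2.1
  have hqq : (q : M) * q = q := q.2.1
  constructor
  · intro h
    have h' : IsCompl (corner (q : M) 1) (corner (1 - (p : M)) 1) := h
    have hzero : ∀ m : M, (q : M) * m = m → (1 - (p : M)) * m = m → m = 0 := fun m h₁ h₂ =>
      Submodule.disjoint_def.1 h'.1 m (show _ * m * 1 = m by rw [mul_one, h₁])
        (show _ * m * 1 = m by rw [mul_one, h₂])
    obtain ⟨a, ha, b, hb, hab⟩ := Submodule.mem_sup.1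
      (show (1 : M) ∈ corner (q : M) 1 ⊔ corner (1 - (p : M)) 1 by
        rw [h'.sup_eq_top]; trivial)
    have ha' : (q : M) * a = a := by
      have : (q : M) * a * 1 = a := ha
      rwa [mul_one] at this
    have hb' : (1 - (p : M)) * b = b := by
      have : (1 - (p : M)) * b * 1 = b := hb
      rwa [mul_one] at this
    have hpb : (p : M) * b = 0 := by
      rw [← hb', ← mul_assoc, mul_sub, mul_one, hpp, sub_self, zero_mul]
    refine ⟨a, ?_, ha', ?_, ?_⟩
    · have : a * (1 - p) = 0 := by
        refine hzero _ (by rw [← mul_assoc, ha']) ?_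
        have e : a = 1 - b := eq_sub_of_add_eq hab
        rw [sub_mul, one_mul, sub_eq_self, e, sub_mul, one_mul, mul_sub, mul_sub, hpp, mul_one,
          sub_self, ← mul_assoc, hpb, zero_mul, sub_zero]
      rw [mul_sub, mul_one, sub_eq_zero] at this
      exact this.symm
    · rw [eq_sub_of_add_eq hab, mul_sub, mul_one, hpb, sub_zero]
    · have e : (q : M) - a * q = b * q := by rw [← one_sub_mul, ← hab, add_sub_cancel_left]
      refine (sub_eq_zero.1 (hzero _ ?_ ?_)).symm
      · rw [mul_sub, ← mul_assoc, ha', hqq]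
      · rw [e, ← mul_assoc, hb']
  · rintro ⟨s, h⟩
    refine ⟨Submodule.disjoint_def.2 fun m h₁ h₂ => ?_, codisjoint_iff.2 ?_⟩
    · have h₁' : (q : M) * m = m := by
        have : (q : M) * m * 1 = m := h₁
        rwa [mul_one] at this
      have h₂' : (p : M) * m = 0 := by
        have : (1 - (p : M)) * m * 1 = m := h₂
        rw [mul_one] at this
        rw [← this, ← mul_assoc, mul_sub, mul_one, hpp, sub_self, zero_mul]
      calc m = s * m := by
            conv_rhs => rw [← h₁']
            rw [← mul_assoc, h.mul_target, h₁']
        _ = 0 := by rw [← h.mul_source, mul_assoc, h₂', mul_zero]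
    · refine eq_top_iff.2 fun m _ => Submodule.mem_sup.2 ⟨s * m, ?_, (1 - s) * m, ?_, ?_⟩
      · change (q : M) * (s * m) * 1 = s * m
        rw [mul_one, ← mul_assoc, h.target_mul]
      · change (1 - (p : M)) * ((1 - s) * m) * 1 = (1 - s) * m
        rw [mul_one, ← mul_assoc, sub_mul (1 : M), one_mul, mul_sub, mul_one, h.source_mul,
          sub_self, sub_zero]
      · rw [← add_mul, add_sub_cancel, one_mul]

theorem mul_of_mem_corner {a b m : M} (ha : a * a = a) (hm : m ∈ corner a b) : a * m = m := by
  have : a * m * b = m := hm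
  rw [← this, ← mul_assoc, ← mul_assoc, ha]

theorem mul_of_mem_corner' {a b m : M} (hb : b * b = b) (hm : m ∈ corner a b) : m * b = m := by
  have : a * m * b = m := hm
  rw [← this, mul_assoc, hb]

theorem mem_corner {a b m : M} (h₁ : a * m = m) (h₂ : m * b = m) : m ∈ corner a b := by
  change a * m * b = m
  rw [h₁, h₂]

theorem proj_mul_of_mem_corner {p m : M} (hp : IsStarProjection p) (hm : m ∈ corner (1 - p) p) :
    p * m = 0 := by
  have h := mul_of_mem_corner hp.one_sub.1 hm
  rw [← h, ← mul_assoc, mul_sub, mul_one, hp.1.eq, sub_self, zero_mul]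

/-- On `Π_p`, the section `σ_p(q)` is the oblique idempotent. -/
theorem isOblique_projSection {p q : Proj M} (hq : q ∈ nearProj p) :
    IsOblique (p : M) q (projSection p q) := by
  obtain ⟨s, hs⟩ := mem_nearProj_iff.1 hq
  have hex : ∃ y : corner (1 - (p : M)) (p : M), (q : M) * ((p : M) + y) = p + y :=
    ⟨⟨s - p, hs.sub_mem p.2⟩, by simp [hs.target_mul]⟩
  have hc : projCoord p q = hex.choose := by rw [projCoord, dif_pos hex]
  have hspec := hex.choose_spec
  rw [← hc] at hspec
  have : projSection p q = s := by
    have hm := (projCoord p q).2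
    refine hs.unique_of hspec ?_
    rw [projSection, mul_add, p.2.1.eq, proj_mul_of_mem_corner p.2 hm, add_zero]
  rw [this]
  exact hs

theorem IsOblique.projSection_eq {p q : Proj M} {s : M} (h : IsOblique (p : M) q s) :
    projSection p q = s := by
  have h' := isOblique_projSection (mem_nearProj_iff.2 ⟨s, h⟩)
  exact h.unique_of h'.target_mul h'.source_mul

theorem IsOblique.projCoord_coe {p q : Proj M} {s : M} (h : IsOblique (p : M) q s) :
    (projCoord p q : M) = s - p := by
  rw [← h.projSection_eq, projSection, add_sub_cancel_left]

theorem isUnit_one_add_star_mul_self (y : M) : IsUnit (1 + star y * y) := by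
  by_contra h
  have h₁ : (-1 : ℝ) ∈ spectrum ℝ (star y * y) := by
    rw [spectrum.mem_iff]
    intro h'
    refine h ?_
    have := h'.neg
    simpa [add_comm] using this
  have := spectrum_star_mul_self_nonneg _ h₁
  norm_num at this

/-- The inverse `(1 + y⋆ y)⁻¹ (p + y)⋆` of the arrow `p + y`, for `y ∈ (1 - p) M p`. -/
noncomputable def graphInv (p y : M) : M :=
  Ring.inverse (1 + star y * y) * star (p + y)

/-- Every `y ∈ (1 - p) M p` gives an arrow `p + y` with source `p`, because
`(p + y)⋆ (p + y) = (1 + y⋆ y) p` and `1 + y⋆ y` is invertible. -/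
theorem isArrow_graph {p y : M} (hp : IsStarProjection p) (hy : y ∈ corner (1 - p) p) :
    IsArrow ((p + y) * graphInv p y) p (p + y) (graphInv p y) := by
  have hpp : p * p = p := hp.1
  have hps : star p = p := hp.2
  have hyp : y * p = y := mul_of_mem_corner' hpp hy
  have hpy : p * y = 0 := proj_mul_of_mem_corner hp hy
  have hpys : p * star y = star y := by
    have := congrArg star hyp
    rwa [star_mul, hps] at this
  have hysp : star y * p = 0 := by
    have := congrArg star hpy
    rwa [star_mul, hps, star_zero] at this
  have hu := isUnit_one_add_star_mul_self y
  set g := 1 + star y * y with hg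
  set gi := Ring.inverse g with hgi
  have h₁ : g * gi = 1 := Ring.mul_inverse_cancel g hu
  have h₂ : gi * g = 1 := Ring.inverse_mul_cancel g hu
  have hss : star (p + y) * (p + y) = g * p := by
    rw [star_add, hps, hg]
    simp only [add_mul, mul_add, hpp, hpy, hysp, one_mul, mul_assoc, hyp, add_zero, zero_add]
  have hgp : g * p = p * g := by
    rw [hg]
    simp only [add_mul, mul_add, one_mul, mul_one, mul_assoc, hyp]
    rw [← mul_assoc p, hpys]
  have hgs : star g = g := by simp [hg]
  have hgis : star gi = gi := by
    have h₃ : star gi * g = 1 := by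
      have := congrArg star h₁
      rwa [star_mul, star_one, hgs] at this
    exact left_inv_eq_right_inv h₃ h₁
  have hpgi : p * gi = gi * p := by
    calc p * gi = gi * g * p * gi := by rw [h₂, one_mul]
      _ = gi * p * (g * gi) := by rw [mul_assoc gi, hgp]; simp only [mul_assoc]
      _ = gi * p := by rw [h₁, mul_one]
  have hinv : graphInv p y * (p + y) = p := by
    change gi * star (p + y) * (p + y) = p
    rw [mul_assoc, hss, ← mul_assoc, h₂, one_mul]
  have hsp : (p + y) * p = p + y := by rw [add_mul, hpp, hyp]
  refine ⟨rfl, hinv, ?_, ?_, ?_, hps⟩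
  · rw [mul_assoc, hinv, hsp]
  · change p * (gi * star (p + y)) = gi * star (p + y)
    rw [← mul_assoc, hpgi, mul_assoc]
    congr 1
    have := congrArg star hsp
    rwa [star_mul, hps] at this
  · change star ((p + y) * (gi * star (p + y))) = _
    simp only [star_mul, star_star, hgis, mul_assoc, graphInv]
    rfl

/-- An arrow `s` with source `p` and `p s = p` is the oblique idempotent of its target. -/
theorem IsArrow.isOblique {p q s t : M} (h : IsArrow q p s t) (hps : p * s = p) :
    IsOblique p q s where
  mul_source := h.mul_source
  target_mul := h.target_mul
  source_mul := hps
  mul_target := by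
    have hss : s * s = s := by
      calc s * s = s * (p * s) := by rw [← mul_assoc, h.mul_source]
        _ = s := by rw [hps, h.mul_source]
    rw [← h.mul_inv, ← mul_assoc, hss]

/-- Change of the base point of the oblique idempotents: if `p' s` is an arrow with inverse `t`
then `s t` is the oblique idempotent over `p'`. -/
theorem IsOblique.change {p p' q s t : M} (h : IsOblique p q s) (ht : IsArrow p' p (p' * s) t) :
    IsOblique p' q (s * t) where
  mul_source := by rw [mul_assoc, ht.mul_target]
  target_mul := by rw [← mul_assoc, h.target_mul]
  source_mul := by rw [← mul_assoc, ht.mul_inv]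
  mul_target := by
    have e : s * t * p' * s = s := by
      rw [mul_assoc, mul_assoc, ht.inv_mul, h.mul_source]
    calc s * t * q = s * t * p' * (s * q) := by
          rw [h.mul_target, mul_assoc s t p', ht.mul_target]
      _ = q := by rw [← mul_assoc, e, h.mul_target]

/-- Conversely, if `q` has oblique idempotents over both `p` and `p'` then `p' s` is an arrow. -/
theorem IsOblique.isArrow_mul {p p' q s s' : M} (hp : IsStarProjection p)
    (hp' : IsStarProjection p') (h : IsOblique p q s) (h' : IsOblique p' q s') :
    IsArrow p' p (p' * s) (p * s') where
  mul_inv := by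
    rw [mul_assoc, ← mul_assoc s, h.mul_source]
    conv_lhs => rw [← h'.target_mul]
    rw [← mul_assoc s, h.mul_target, h'.target_mul, h'.source_mul]
  inv_mul := by
    rw [mul_assoc, ← mul_assoc s', h'.mul_source]
    conv_lhs => rw [← h.target_mul]
    rw [← mul_assoc s', h'.mul_target, h.target_mul, h.source_mul]
  target_mul := by rw [← mul_assoc, hp'.1.eq]
  source_mul := by rw [← mul_assoc, hp.1.eq]
  star_target := hp'.2
  star_source := hp.2

/-! ### Analyticity of the inversion between fixed supports -/

section Analytic

variable {q p z t : M}

/-- Near an arrow `z` with inverse `t`, an element `x` of `q M p` is an arrow as soon as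
`t x + (1 - p)` is invertible, and this gives the inverse of `x`. -/
theorem IsArrow.of_isUnit {x : M} (h : IsArrow q p z t) (hq : q * x = x) (hp : x * p = x)
    (hu : IsUnit (1 + t * (x - z))) : IsArrow q p x (Ring.inverse (1 + t * (x - z)) * t) := by
  set g := 1 + t * (x - z) with hg
  have h₁ : g * Ring.inverse g = 1 := Ring.mul_inverse_cancel g hu
  have h₂ : Ring.inverse g * g = 1 := Ring.inverse_mul_cancel g hu
  have hpp : p * p = p := h.symm.target_idem
  have hge : g = 1 - p + t * x := by rw [hg, mul_sub, h.inv_mul]; abel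
  have hgp : g * p = t * x := by
    rw [hge, add_mul, sub_mul, one_mul, hpp, sub_self, zero_add, mul_assoc, hp]
  have hpg : p * g = t * x := by
    rw [hge, mul_add, mul_sub, mul_one, hpp, sub_self, zero_add, ← mul_assoc, h.source_mul]
  have hzg : z * g = x := by
    rw [hge, mul_add, mul_sub, mul_one, h.mul_source, sub_self, zero_add, ← mul_assoc, h.mul_inv,
      hq]
  have hpi : p * Ring.inverse g = Ring.inverse g * p := by
    calc p * Ring.inverse g = Ring.inverse g * (g * p) * Ring.inverse g := by
          rw [← mul_assoc, h₂, one_mul]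
      _ = Ring.inverse g * p * (g * Ring.inverse g) := by
          rw [hgp, ← hpg]
          simp only [mul_assoc]
      _ = Ring.inverse g * p := by rw [h₁, mul_one]
  refine ⟨?_, ?_, hq, ?_, h.star_target, h.star_source⟩
  · rw [← hzg, ← mul_assoc, mul_assoc z, h₁, mul_one, h.mul_inv]
  · rw [mul_assoc, ← hgp, ← mul_assoc, h₂, one_mul]
  · rw [← mul_assoc, hpi, mul_assoc, h.source_mul]

variable {𝕜 : Type*} [NontriviallyNormedField 𝕜] [NormedAlgebra 𝕜 M]
  {E : Type*} [NormedAddCommGroup E] [NormedSpace 𝕜 E] {g : E → M} {e : E}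

theorem eventually_isArrow (hg : ContinuousAt g e) (hq : ∀ v, q * g v = g v)
    (hp : ∀ v, g v * p = g v) (h : IsArrow q p (g e) t) :
    ∀ᶠ v in 𝓝 e, IsArrow q p (g v) (inversion (g v)) ∧
      inversion (g v) = Ring.inverse (1 + t * (g v - g e)) * t := by
  have hc : ContinuousAt (fun v => 1 + t * (g v - g e)) e := by fun_prop
  have hu : {a : M | IsUnit a} ∈ 𝓝 ((fun v => 1 + t * (g v - g e)) e) :=
    Units.isOpen.mem_nhds (by simp)
  filter_upwards [hc hu] with v hv
  have hv' := h.of_isUnit (hq v) (hp v) hv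
  rw [hv'.inversion_eq]
  exact ⟨hv', rfl⟩

theorem analyticAt_inversion (hg : AnalyticAt 𝕜 g e) (hq : ∀ v, q * g v = g v)
    (hp : ∀ v, g v * p = g v) (h : IsArrow q p (g e) t) :
    AnalyticAt 𝕜 (fun v => inversion (g v)) e := by
  have hc : AnalyticAt 𝕜 (fun v => 1 + t * (g v - g e)) e :=
    analyticAt_const.add (analyticAt_const.mul (hg.sub analyticAt_const))
  have hi : AnalyticAt 𝕜 Ring.inverse ((fun v => 1 + t * (g v - g e)) e) := by
    have := analyticAt_inverse (𝕜 := 𝕜) (1 : Mˣ)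
    simpa using this
  have h₁ := (AnalyticAt.comp (f := fun v => 1 + t * (g v - g e)) hi hc).mul
    (analyticAt_const (v := t))
  refine h₁.congr ?_
  filter_upwards [eventually_isArrow hg.continuousAt hq hp h] with v hv
  exact hv.2.symm

theorem analyticAt_star {a : M} : AnalyticAt ℝ (star : M → M) a :=
  ((starL' ℝ : M ≃L[ℝ] M) : M →L[ℝ] M).analyticAt a

theorem analyticAt_star_comp {F : Type*} [NormedAddCommGroup F] [NormedSpace ℝ F] {g : F → M}
    {e : F} (hg : AnalyticAt ℝ g e) : AnalyticAt ℝ (fun v => star (g v)) e :=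
  (analyticAt_star (a := g e)).comp hg

theorem analyticAt_graphInv (p y : M) : AnalyticAt ℝ (graphInv p) y := by
  have h₁ : AnalyticAt ℝ (fun y : M => 1 + star y * y) y :=
    analyticAt_const.add (analyticAt_star.mul analyticAt_id)
  have h₂ : AnalyticAt ℝ Ring.inverse ((fun y : M => 1 + star y * y) y) := by
    obtain ⟨u, hu⟩ := isUnit_one_add_star_mul_self y
    change AnalyticAt ℝ Ring.inverse (1 + star y * y)
    rw [← hu]
    exact analyticAt_inverse u
  have h₃ : AnalyticAt ℝ (fun y : M => star (p + y)) y := by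
    exact analyticAt_star_comp (analyticAt_const.add analyticAt_id)
  exact (AnalyticAt.comp (f := fun y : M => 1 + star y * y) h₂ h₁).mul h₃

end Analytic

/-! ### The charts of the groupoid -/

section Charts

/-- The complement `1 - p` of a projection. -/
def complProj (p : Proj M) : Proj M := ⟨1 - p, p.2.one_sub⟩

/-- The compression `m ↦ p m q`, as a continuous linear map. -/
noncomputable def compressL (p q : Proj M) : M →L[ℂ] corner (p : M) (q : M) where
  toFun := compress p q
  map_add' x y := Subtype.ext (by simp [compress, mul_add, add_mul])
  map_smul' c x := Subtype.ext (by simp [compress])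
  cont := by
    refine Continuous.subtype_mk ?_ _
    fun_prop

theorem compressL_coe (p q : Proj M) (m : M) : (compressL p q m : M) = p * m * q := rfl

theorem compress_self {p q : Proj M} (m : corner (p : M) (q : M)) : compress p q (m : M) = m :=
  Subtype.ext m.2

theorem corner_left {p q : Proj M} (m : corner (p : M) (q : M)) : (p : M) * m = m :=
  mul_of_mem_corner p.2.1 m.2

theorem corner_right {a : M} {q : Proj M} (m : corner a (q : M)) : (m : M) * q = m :=
  mul_of_mem_corner' q.2.1 m.2

theorem IsArrow.mem_corner {q p x y : M} (h : IsArrow q p x y) : x ∈ corner q p :=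
  WStarGroupoid.mem_corner h.target_mul h.mul_source

theorem isArrow_coe (x : partiallyInvertible M) :
    IsArrow (leftSupport (x : M) : M) (rightSupport (x : M)) x (inversion (x : M)) :=
  isArrow_of_mem x.2

variable {q p : Proj M}

/-- The middle coordinate of `x` is `q x σ_p(r(x))`, because `ι(σ_q(l(x))) = q l(x)`. -/
theorem groupoidChart_middle {x : partiallyInvertible M} (hx : x ∈ chartDomain q p) :
    (((groupoidChart q p).toFun x).2.1 : M) = q * x * projSection p (rightSupport (x : M)) := by
  have hl := isOblique_projSection hx.1
  have hr := isOblique_projSection hx.2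
  change (q : M) * (inversion (projSection q (leftSupport (x : M))) * (x : M) *
    projSection p (rightSupport (x : M))) * p = _
  rw [(hl.isArrow q.2 (leftSupport (x : M)).2).inversion_eq]
  simp only [mul_assoc]
  rw [hr.mul_source, ← mul_assoc (leftSupport (x : M) : M) (x : M), (isArrow_coe x).target_mul,
    ← mul_assoc (q : M) q, q.2.1.eq]

theorem isArrow_groupoidChart_middle {x : partiallyInvertible M} (hx : x ∈ chartDomain q p) :
    IsArrow (q : M) p (((groupoidChart q p).toFun x).2.1 : M)
      (p * inversion (x : M) * projSection q (leftSupport (x : M))) := by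
  have hl := (isOblique_projSection hx.1).isArrow q.2 (leftSupport (x : M)).2
  have hr := (isOblique_projSection hx.2).isArrow p.2 (rightSupport (x : M)).2
  have h := (hl.symm.comp (isArrow_coe x)).comp hr
  rw [groupoidChart_middle hx]
  rw [mul_assoc (q : M), (isArrow_coe x).target_mul] at h
  rw [mul_assoc (p : M), ← mul_assoc (rightSupport (x : M) : M), (isArrow_coe x).source_mul,
    ← mul_assoc] at h
  exact h

/-- The element with coordinates `(y', z, y)`: the arrow `(q + y') z ι(p + y)`. -/
noncomputable def chartPoint (q p : Proj M) (y' z y : M) : M := (q + y') * z * graphInv (p : M) y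

/-- The inverse of the element with coordinates `(y', z, y)`. -/
noncomputable def chartPointInv (q p : Proj M) (y' z y : M) : M :=
  (p + y) * inversion z * graphInv (q : M) y'

theorem isArrow_chartPoint {y' z y t : M} (hy' : y' ∈ corner (1 - (q : M)) q)
    (hz : IsArrow (q : M) p z t) (hy : y ∈ corner (1 - (p : M)) p) :
    IsArrow ((q + y') * graphInv (q : M) y') ((p + y) * graphInv (p : M) y) (chartPoint q p y' z y)
      (chartPointInv q p y' z y) := by
  have h := ((isArrow_graph q.2 hy').comp hz).comp (isArrow_graph p.2 hy).symm
  rw [← mul_assoc, ← hz.inversion_eq] at h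
  exact h

theorem chartPoint_groupoidChart {x : partiallyInvertible M} (hx : x ∈ chartDomain q p) :
    chartPoint q p (((groupoidChart q p).toFun x).1 : M) (((groupoidChart q p).toFun x).2.1 : M)
      (((groupoidChart q p).toFun x).2.2 : M) = x := by
  have hl := isOblique_projSection hx.1
  have hr := isOblique_projSection hx.2
  have hg : graphInv (p : M) (projCoord p (rightSupport (x : M)) : M)
      = p * (rightSupport (x : M) : M) := by
    rw [← (isArrow_graph p.2 (projCoord p (rightSupport (x : M))).2).inversion_eq]
    exact (hr.isArrow p.2 (rightSupport (x : M)).2).inversion_eq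
  rw [groupoidChart_middle hx]
  change projSection q (leftSupport (x : M)) * _ *
    graphInv _ (projCoord p (rightSupport (x : M)) : M) = _
  rw [hg]
  simp only [mul_assoc]
  rw [← mul_assoc (projSection p _) (p : M), hr.mul_source, hr.mul_target,
    (isArrow_coe x).mul_source, ← mul_assoc, hl.mul_source]
  have hx' := (isArrow_coe x).target_mul
  calc projSection q (leftSupport (x : M)) * (x : M)
      = projSection q (leftSupport (x : M)) * leftSupport (x : M) * x := by rw [mul_assoc, hx']
    _ = x := by rw [hl.mul_target, hx']

theorem chartPointInv_groupoidChart {x : partiallyInvertible M} (hx : x ∈ chartDomain q p) :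
    chartPointInv q p (((groupoidChart q p).toFun x).1 : M)
      (((groupoidChart q p).toFun x).2.1 : M)
      (((groupoidChart q p).toFun x).2.2 : M) = inversion (x : M) := by
  have h := isArrow_chartPoint ((groupoidChart q p).toFun x).1.2 (isArrow_groupoidChart_middle hx)
    ((groupoidChart q p).toFun x).2.2.2
  rw [chartPoint_groupoidChart hx] at h
  exact h.inversion_eq.symm

theorem injOn_groupoidChart (q p : Proj M) :
    Set.InjOn (groupoidChart q p).toFun (groupoidChart q p).source := by
  intro x hx x' hx' h
  refine Subtype.ext ?_
  rw [← chartPoint_groupoidChart hx, ← chartPoint_groupoidChart hx', h]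

/-- If `z`, `q' (q + y')` and `p' (p + y)` are arrows then the element with coordinates `(y', z, y)`
over `(q, p)` is in the domain of the chart over `(q', p')`, with the stated coordinates. These
formulas do not involve the adjoint, so that the transition is holomorphic. -/
theorem chartPoint_mem_chartDomain {q' p' : Proj M} {y' z y t : M}
    (hy' : y' ∈ corner (1 - (q : M)) q)
    (hz : IsArrow (q : M) p z t) (hy : y ∈ corner (1 - (p : M)) p)
    (hq : IsArrow (q' : M) q (q' * (q + y')) (inversion (q' * (q + y'))))
    (hp : IsArrow (p' : M) p (p' * (p + y)) (inversion (p' * (p + y)))) :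
    ∃ x : partiallyInvertible M, (x : M) = chartPoint q p y' z y ∧ x ∈ chartDomain q' p' ∧
      (groupoidChart q' p').toFun x =
        (compressL (complProj q') q' ((q + y') * inversion (q' * (q + y'))),
          compressL q' p' (q' * (q + y') * z * inversion (p' * (p + y))),
          compressL (complProj p') p' ((p + y) * inversion (p' * (p + y)))) := by
  have hx := isArrow_chartPoint hy' hz hy
  refine ⟨⟨chartPoint q p y' z y, hx.mem_partiallyInvertible⟩, rfl, ?_⟩
  have hl := hx.leftSupport_coe
  have hr := hx.rightSupport_coe
  have aux : ∀ (p : Proj M) (y : M), y ∈ corner (1 - (p : M)) p → (p : M) * (p + y) = p :=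
    fun p y hy => by rw [mul_add, p.2.1.eq, proj_mul_of_mem_corner p.2 hy, add_zero]
  have hol := ((isArrow_graph q.2 hy').isOblique (aux q y' hy')).change hq
  have hor := ((isArrow_graph p.2 hy).isOblique (aux p y hy)).change hp
  rw [← hl] at hol
  rw [← hr] at hor
  have hmem : (⟨chartPoint q p y' z y, hx.mem_partiallyInvertible⟩ : partiallyInvertible M) ∈
      chartDomain q' p' := ⟨mem_nearProj_iff.2 ⟨_, hol⟩, mem_nearProj_iff.2 ⟨_, hor⟩⟩
  have aux₂ : ∀ (p' l : Proj M) (s : M), IsOblique (p' : M) l s →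
      projCoord p' l = compressL (complProj p') p' s := by
    intro p' l s h
    refine Subtype.ext ?_
    rw [h.projCoord_coe, compressL_coe]
    change s - p' = (1 - (p' : M)) * s * p'
    rw [sub_mul, sub_mul, one_mul, h.source_mul, h.mul_source, p'.2.1.eq]
  refine ⟨hmem, Prod.ext (aux₂ _ _ _ hol) (Prod.ext (Subtype.ext ?_) (aux₂ _ _ _ hor))⟩
  rw [groupoidChart_middle hmem, hor.projSection_eq, compressL_coe]
  change (q' : M) * ((q + y') * z * graphInv (p : M) y) * _ = _
  simp only [mul_assoc]
  rw [← mul_assoc (graphInv (p : M) y), (isArrow_graph p.2 hy).inv_mul, hp.source_mul,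
    hp.mul_target, ← mul_assoc (q' : M) q', q'.2.1.eq]

theorem chartPoint_mem_chartDomain_self {y' z y t : M}
    (hy' : y' ∈ corner (1 - (q : M)) q)
    (hz : IsArrow (q : M) p z t) (hy : y ∈ corner (1 - (p : M)) p) :
    ∃ x : partiallyInvertible M, (x : M) = chartPoint q p y' z y ∧ x ∈ chartDomain q p ∧
      (groupoidChart q p).toFun x = (⟨y', hy'⟩, ⟨z, hz.mem_corner⟩, ⟨y, hy⟩) := by
  have aux : ∀ (p : Proj M) (y : M), y ∈ corner (1 - (p : M)) p → (p : M) * (p + y) = p :=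
    fun p y hy => by rw [mul_add, p.2.1.eq, proj_mul_of_mem_corner p.2 hy, add_zero]
  have aux₂ : ∀ (p : Proj M), inversion (p : M) = p := fun p => (IsArrow.refl p.2).inversion_eq
  have aux₃ : ∀ (p : Proj M) (y : M) (hy : y ∈ corner (1 - (p : M)) p),
      compressL (complProj p) p (p + y) = ⟨y, hy⟩ := by
    intro p y hy
    refine Subtype.ext ?_
    rw [compressL_coe]
    change (1 - (p : M)) * (p + y) * p = y
    rw [mul_add, sub_mul, one_mul, p.2.1.eq, sub_self, zero_add]
    exact hy
  have hq := aux q y' hy'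
  have hp := aux p y hy
  have hqa : (q + y') * (q : M) = q + y' := by
    rw [add_mul, q.2.1.eq, mul_of_mem_corner' q.2.1 hy']
  have hpa : (p + y) * (p : M) = p + y := by
    rw [add_mul, p.2.1.eq, mul_of_mem_corner' p.2.1 hy]
  obtain ⟨x, hx, hxs, hxv⟩ := chartPoint_mem_chartDomain (q' := q) (p' := p) hy' hz hy
    (by rw [hq, aux₂]; exact IsArrow.refl q.2) (by rw [hp, aux₂]; exact IsArrow.refl p.2)
  refine ⟨x, hx, hxs, ?_⟩
  rw [hxv, hq, hp, aux₂, aux₂, hqa, hpa, aux₃ q y' hy', aux₃ p y hy]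
  refine Prod.ext rfl (Prod.ext (Subtype.ext ?_) rfl)
  rw [compressL_coe, hz.target_mul, hz.mul_source, hz.target_mul, hz.mul_source]

/-- The coordinate `y'` of the target, as an element of the algebra. -/
noncomputable def coordL₁ (q p : Proj M) : (groupoidChart q p).Model →L[ℂ] M :=
  (corner (1 - (q : M)) (q : M)).subtypeL.comp (ContinuousLinearMap.fst ℂ _ _)

/-- The middle coordinate `z`, as an element of the algebra. -/
noncomputable def coordL₂ (q p : Proj M) : (groupoidChart q p).Model →L[ℂ] M :=
  (corner (q : M) (p : M)).subtypeL.comp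
    ((ContinuousLinearMap.fst ℂ _ _).comp (ContinuousLinearMap.snd ℂ _ _))

/-- The coordinate `y` of the source, as an element of the algebra. -/
noncomputable def coordL₃ (q p : Proj M) : (groupoidChart q p).Model →L[ℂ] M :=
  (corner (1 - (p : M)) (p : M)).subtypeL.comp
    ((ContinuousLinearMap.snd ℂ _ _).comp (ContinuousLinearMap.snd ℂ _ _))

theorem coordL₁_mem (e : (groupoidChart q p).Model) :
    coordL₁ q p e ∈ corner (1 - (q : M)) q := e.1.2

theorem coordL₂_left (e : (groupoidChart q p).Model) :
    (q : M) * coordL₂ q p e = coordL₂ q p e := corner_left e.2.1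

theorem coordL₂_right (e : (groupoidChart q p).Model) :
    coordL₂ q p e * p = coordL₂ q p e := corner_right e.2.1

theorem coordL₃_mem (e : (groupoidChart q p).Model) :
    coordL₃ q p e ∈ corner (1 - (p : M)) p := e.2.2.2

theorem eventually_isArrow_middle {x : partiallyInvertible M} (hx : x ∈ chartDomain q p) :
    ∀ᶠ e in 𝓝 ((groupoidChart q p).toFun x),
      IsArrow (q : M) p (coordL₂ q p e) (inversion (coordL₂ q p e)) := by
  filter_upwards [eventually_isArrow (g := coordL₂ q p) (coordL₂ q p).continuous.continuousAt
    coordL₂_left coordL₂_right (isArrow_groupoidChart_middle hx)] with e he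
  exact he.1

/-- Two charts of the groupoid are compatible: near the coordinates of `x` the triples with arrows
`z`, `q' (q + y')` and `p' (p + y)` are the coordinates of points of both domains. -/
theorem transitionAt_groupoidChart (q p q' p' : Proj M) {x : partiallyInvertible M}
    (hx : x ∈ chartDomain q p ∩ chartDomain q' p') :
    (groupoidChart q p).TransitionAt (groupoidChart q' p') x := by
  set e₀ := (groupoidChart q p).toFun x with he₀
  have a₁ : AnalyticAt ℂ (fun e => (q : M) + coordL₁ q p e) e₀ :=
    analyticAt_const.add ((coordL₁ q p).analyticAt e₀)
  have a₂ : AnalyticAt ℂ (coordL₂ q p) e₀ := (coordL₂ q p).analyticAt e₀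
  have a₃ : AnalyticAt ℂ (fun e => (p : M) + coordL₃ q p e) e₀ :=
    analyticAt_const.add ((coordL₃ q p).analyticAt e₀)
  have a₄ : AnalyticAt ℂ (fun e => (q' : M) * ((q : M) + coordL₁ q p e)) e₀ :=
    analyticAt_const.mul a₁
  have a₅ : AnalyticAt ℂ (fun e => (p' : M) * ((p : M) + coordL₃ q p e)) e₀ :=
    analyticAt_const.mul a₃
  have l₄ : ∀ e, (q' : M) * (q' * ((q : M) + coordL₁ q p e)) = q' * (q + coordL₁ q p e) :=
    fun e => by rw [← mul_assoc, q'.2.1.eq]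
  have r₄ : ∀ e, (q' : M) * ((q : M) + coordL₁ q p e) * q = q' * (q + coordL₁ q p e) :=
    fun e => by rw [mul_assoc, add_mul, q.2.1.eq, mul_of_mem_corner' q.2.1 (coordL₁_mem e)]
  have l₅ : ∀ e, (p' : M) * (p' * ((p : M) + coordL₃ q p e)) = p' * (p + coordL₃ q p e) :=
    fun e => by rw [← mul_assoc, p'.2.1.eq]
  have r₅ : ∀ e, (p' : M) * ((p : M) + coordL₃ q p e) * p = p' * (p + coordL₃ q p e) :=
    fun e => by rw [mul_assoc, add_mul, p.2.1.eq, mul_of_mem_corner' p.2.1 (coordL₃_mem e)]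
  have i₄ := (isOblique_projSection hx.1.1).isArrow_mul q.2 q'.2 (isOblique_projSection hx.2.1)
  have i₅ := (isOblique_projSection hx.1.2).isArrow_mul p.2 p'.2 (isOblique_projSection hx.2.2)
  have b₄ := analyticAt_inversion a₄ l₄ r₄ i₄
  have b₅ := analyticAt_inversion a₅ l₅ r₅ i₅
  refine ⟨fun e => (compressL (complProj q') q'
      ((q + coordL₁ q p e) * inversion (q' * (q + coordL₁ q p e))),
    compressL q' p' (q' * (q + coordL₁ q p e) * coordL₂ q p e *
      inversion (p' * (p + coordL₃ q p e))),
    compressL (complProj p') p' ((p + coordL₃ q p e) * inversion (p' * (p + coordL₃ q p e)))),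
    ?_, ?_⟩
  · exact AnalyticAt.prod (((compressL (complProj q') q').analyticAt _).comp (a₁.mul b₄))
      (AnalyticAt.prod (((compressL q' p').analyticAt _).comp ((a₄.mul a₂).mul b₅))
        (((compressL (complProj p') p').analyticAt _).comp (a₃.mul b₅)))
  · filter_upwards [eventually_isArrow_middle hx.1, eventually_isArrow a₄.continuousAt l₄ r₄ i₄,
      eventually_isArrow a₅.continuousAt l₅ r₅ i₅] with e h₂ h₄ h₅
    obtain ⟨x₁, hx₁, hs₁, hv₁⟩ := chartPoint_mem_chartDomain_self (coordL₁_mem e) h₂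
      (coordL₃_mem e)
    obtain ⟨x₂, hx₂, hs₂, hv₂⟩ := chartPoint_mem_chartDomain (coordL₁_mem e) h₂
      (coordL₃_mem e) h₄.1 h₅.1
    obtain rfl : x₁ = x₂ := Subtype.ext (hx₁.trans hx₂.symm)
    exact ⟨x₁, ⟨hs₁, hs₂⟩, hv₁, hv₂⟩

theorem mem_chartDomain_self (x : partiallyInvertible M) :
    x ∈ chartDomain (leftSupport (x : M)) (rightSupport (x : M)) := by
  have aux : ∀ p : Proj M, p ∈ nearProj p := fun p =>
    mem_nearProj_iff.2 ⟨p, ⟨p.2.1, p.2.1, p.2.1, p.2.1⟩⟩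
  exact ⟨aux _, aux _⟩

theorem exists_groupoidChart (x : partiallyInvertible M) :
    ∃ c ∈ groupoidAtlas M, x ∈ c.source :=
  ⟨_, ⟨_, _, ⟨x, x.2, rfl, rfl⟩, rfl⟩, mem_chartDomain_self x⟩

theorem continuousAt_chartPoint {e : (groupoidChart q p).Model} :
    ContinuousAt (fun e => chartPoint q p (coordL₁ q p e) (coordL₂ q p e) (coordL₃ q p e)) e := by
  have h := (analyticAt_graphInv (p : M) (coordL₃ q p e)).continuousAt.comp
    (coordL₃ q p).continuous.continuousAt
  exact ((continuousAt_const.add (coordL₁ q p).continuous.continuousAt).mul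
    (coordL₂ q p).continuous.continuousAt).mul h

theorem continuousAt_chartPointInv {x : partiallyInvertible M} (hx : x ∈ chartDomain q p) :
    ContinuousAt (fun e => chartPointInv q p (coordL₁ q p e) (coordL₂ q p e) (coordL₃ q p e))
      ((groupoidChart q p).toFun x) := by
  set e := (groupoidChart q p).toFun x with he
  have h := (analyticAt_graphInv (q : M) (coordL₁ q p e)).continuousAt.comp
    (coordL₁ q p).continuous.continuousAt
  have h₂ := (analyticAt_inversion ((coordL₂ q p).analyticAt e) coordL₂_left coordL₂_right
    (isArrow_groupoidChart_middle hx)).continuousAt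
  exact ((continuousAt_const.add (coordL₃ q p).continuous.continuousAt).mul h₂).mul h

theorem continuous_coe_atlasTopology :
    @Continuous _ _ (atlasTopology (groupoidAtlas M)) _
      (Subtype.val : partiallyInvertible M → M) := by
  refine continuous_atlasTopology exists_groupoidChart ?_
  rintro _ ⟨q, p, -, rfl⟩ x _
  exact ⟨_, continuousAt_chartPoint, fun y hy => chartPoint_groupoidChart hy⟩

theorem continuous_inversion_atlasTopology :
    @Continuous _ _ (atlasTopology (groupoidAtlas M)) _
      (fun x : partiallyInvertible M => inversion (x : M)) := by
  refine continuous_atlasTopology exists_groupoidChart ?_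
  rintro _ ⟨q, p, -, rfl⟩ x hx
  exact ⟨_, continuousAt_chartPointInv hx, fun y hy => chartPointInv_groupoidChart hy⟩

theorem isBanachAtlas_groupoidAtlas : IsBanachAtlas (groupoidAtlas M) where
  covers := exists_groupoidChart
  isChart := by
    rintro _ ⟨q, p, -, rfl⟩
    exact CoordMap.isChart_of_transitionAt (injOn_groupoidChart q p) fun x hx =>
      transitionAt_groupoidChart q p q p ⟨hx, hx⟩
  compatible := by
    rintro _ ⟨q, p, -, rfl⟩ _ ⟨q', p', -, rfl⟩
    exact CoordMap.analyticTransition_of_transitionAt (injOn_groupoidChart q p) fun x hx =>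
      transitionAt_groupoidChart q p q' p' hx
  hausdorff := @T2Space.of_injective_continuous _ _ (atlasTopology (groupoidAtlas M)) _ _ _
    Subtype.val_injective continuous_coe_atlasTopology

theorem isClosed_unitaryPart :
    @IsClosed _ (atlasTopology (realAtlas (groupoidAtlas M))) (unitaryPart M) := by
  rw [atlasTopology_realAtlas]
  let _ := atlasTopology (groupoidAtlas M)
  have h : unitaryPart M = {x : partiallyInvertible M | star (inversion (x : M)) = x} := by
    ext x
    exact mem_partialIsometries_iff x.2
  rw [h]
  exact isClosed_eq (continuous_inversion_atlasTopology.star) continuous_coe_atlasTopology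

end Charts

/-! ### The derivative of the inversion between fixed supports -/

theorem hasFDerivAt_inversion {q p t : M} {𝕜 : Type*} [NontriviallyNormedField 𝕜]
    [NormedAlgebra 𝕜 M] {E : Type*} [NormedAddCommGroup E] [NormedSpace 𝕜 E] {g : E → M} {e : E}
    {g' : E →L[𝕜] M} (hg : HasFDerivAt g g' e) (hq : ∀ v, q * g v = g v)
    (hp : ∀ v, g v * p = g v) (h : IsArrow q p (g e) t) :
    HasFDerivAt (fun v => inversion (g v)) (-(ContinuousLinearMap.mulLeftRight 𝕜 M t t).comp g')
      e := by
  have h₁ : HasFDerivAt (fun v => 1 + t * (g v - g e)) (ContinuousLinearMap.mul 𝕜 M t ∘L g') e := by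
    have := ((ContinuousLinearMap.mul 𝕜 M t).hasFDerivAt.comp e (hg.sub_const (g e))).const_add 1
    exact this
  have h₂ : HasFDerivAt Ring.inverse (-ContinuousLinearMap.mulLeftRight 𝕜 M 1 1)
      ((fun v => 1 + t * (g v - g e)) e) := by
    have := (hasStrictFDerivAt_ringInverse (𝕜 := 𝕜) (1 : Mˣ)).hasFDerivAt
    simpa using this
  have h₃ := ((ContinuousLinearMap.mul 𝕜 M).flip t).hasFDerivAt.comp e
    (HasFDerivAt.comp (f := fun v => 1 + t * (g v - g e)) e h₂ h₁)
  refine (h₃.congr_of_eventuallyEq ?_).congr_fderiv ?_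
  · filter_upwards [eventually_isArrow hg.continuousAt hq hp h] with v hv
    exact hv.2
  · ext v
    simp

/-- Left multiplication by `i k`, for an arrow `k` from `q` to `p`, as an isomorphism of `q M p`
onto `p M p`. -/
noncomputable def mulArrowEquiv (q p : Proj M) {k t : M} (h : IsArrow (p : M) q k t) :
    corner (q : M) (p : M) ≃L[ℂ] corner (p : M) (p : M) :=
  ContinuousLinearEquiv.equivOfInverse
    ((compressL p p).comp ((ContinuousLinearMap.mul ℂ M (Complex.I • k)).comp
      (corner (q : M) (p : M)).subtypeL))
    ((compressL q p).comp ((ContinuousLinearMap.mul ℂ M (-Complex.I • t)).comp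
      (corner (p : M) (p : M)).subtypeL))
    (fun z => by
      refine Subtype.ext ?_
      change (q : M) * (-Complex.I • t * (p * (Complex.I • k * z) * p)) * p = z
      simp only [smul_mul_assoc, mul_smul_comm, smul_smul]
      rw [← mul_assoc (p : M), h.target_mul, mul_assoc k, corner_right z, ← mul_assoc t, h.inv_mul,
        corner_left, corner_left, corner_right]
      simp)
    (fun z => by
      refine Subtype.ext ?_
      change (p : M) * (Complex.I • k * (q * (-Complex.I • t * z) * p)) * p = z
      simp only [smul_mul_assoc, mul_smul_comm, smul_smul]
      rw [← mul_assoc (q : M), h.source_mul, mul_assoc t, corner_right z, ← mul_assoc k, h.mul_inv,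
        corner_left, corner_left, corner_right]
      simp)

theorem mulArrowEquiv_coe {q p : Proj M} {k t : M} (h : IsArrow (p : M) q k t)
    (z : corner (q : M) (p : M)) : (mulArrowEquiv q p h z : M) = Complex.I • (k * z) := by
  change (p : M) * (Complex.I • k * z) * p = _
  simp only [smul_mul_assoc, mul_smul_comm]
  rw [← mul_assoc, h.target_mul, mul_assoc, corner_right]

/-- The adjoint on `p M p`. -/
noncomputable def cornerStar (p : Proj M) (h : corner (p : M) (p : M)) :
    corner (p : M) (p : M) :=
  compress p p (star (h : M))

theorem cornerStar_coe {p : Proj M} (h : corner (p : M) (p : M)) :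
    (cornerStar p h : M) = star (h : M) := by
  have := congrArg star (show (p : M) * h * p = h from h.2)
  rw [star_mul, star_mul, p.2.2.star_eq, ← mul_assoc] at this
  exact this

theorem cornerStar_eq_iff {p : Proj M} (h : corner (p : M) (p : M)) :
    cornerStar p h = h ↔ star (h : M) = h := by
  rw [← cornerStar_coe, Subtype.ext_iff]

/-! ### The spaces of arrows between two projections -/

section Arrows

variable {q p : Proj M}

theorem isArrow_arrows (x : arrows q p) : IsArrow (q : M) p x (inversion (x : M)) :=
  mem_arrows_iff.1 x.2

/-- The coordinate of an arrow, as an element of the algebra. -/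
noncomputable def arrowsCoord (q p : Proj M) : (arrowsChart q p).Model →L[ℂ] M :=
  (corner (q : M) (p : M)).subtypeL

theorem arrowsCoord_left (v : (arrowsChart q p).Model) :
    (q : M) * arrowsCoord q p v = arrowsCoord q p v :=
  mul_of_mem_corner q.2.1 v.2

theorem arrowsCoord_right (v : (arrowsChart q p).Model) :
    arrowsCoord q p v * p = arrowsCoord q p v :=
  mul_of_mem_corner' p.2.1 v.2

theorem arrowsCoord_toFun (x : arrows q p) :
    arrowsCoord q p ((arrowsChart q p).toFun x) = x := by
  change (q : M) * x * p = x
  rw [(isArrow_arrows x).target_mul, (isArrow_arrows x).mul_source]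

theorem isBanachAtlas_arrowsChart (q p : Proj M) : IsBanachAtlas {arrowsChart q p} := by
  have hinj : Set.InjOn (arrowsChart q p).toFun (arrowsChart q p).source := fun x _ y _ h =>
    Subtype.ext (by rw [← arrowsCoord_toFun x, ← arrowsCoord_toFun y, h])
  have htr : ∀ x, (arrowsChart q p).TransitionAt (arrowsChart q p) x := fun x => by
    refine ⟨id, analyticAt_id, ?_⟩
    have h := isArrow_arrows x
    rw [← arrowsCoord_toFun x] at h
    filter_upwards [eventually_isArrow (arrowsCoord q p).continuous.continuousAt
      arrowsCoord_left arrowsCoord_right h] with v hv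
    exact ⟨⟨arrowsCoord q p v, mem_arrows_iff.2 hv.1⟩, ⟨trivial, trivial⟩, compress_self v,
      compress_self v⟩
  have hcov : ∀ x : arrows q p, ∃ c ∈ ({arrowsChart q p} : Set _), x ∈ c.source :=
    fun x => ⟨_, rfl, trivial⟩
  refine ⟨hcov, ?_, ?_, ?_⟩
  · rintro _ rfl
    exact CoordMap.isChart_of_transitionAt hinj fun x _ => htr x
  · rintro _ rfl _ rfl
    exact CoordMap.analyticTransition_of_transitionAt hinj fun x _ => htr x
  · refine @T2Space.of_injective_continuous _ _ (atlasTopology {arrowsChart q p}) _ _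
      (fun x : arrows q p => (x : M)) Subtype.val_injective ?_
    refine continuous_atlasTopology hcov ?_
    rintro _ rfl x _
    exact ⟨arrowsCoord q p, (arrowsCoord q p).continuous.continuousAt,
      fun y _ => arrowsCoord_toFun y⟩

/-- The involution `J` on the arrows from `p` to `q`. -/
noncomputable def arrowsJ (q p : Proj M) (x : arrows q p) : arrows q p :=
  ⟨involutionJ (x : M), by
    have h := (isArrow_arrows x).symm.adjoint
    exact mem_arrows_iff.2 (by rw [involutionJ, h.inversion_eq]; exact h)⟩

/-- The self-adjoint elements of `p M p`, as a real subspace of `p M p`. -/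
noncomputable def selfAdjointCorner (p : Proj M) : Submodule ℝ (corner (p : M) (p : M)) where
  carrier := {h | cornerStar p h = h}
  add_mem' {a b} ha hb := by
    rw [Set.mem_ofPred_eq, cornerStar_eq_iff] at *
    change star ((a : M) + b) = a + b
    rw [star_add, ha, hb]
  zero_mem' := by
    rw [Set.mem_ofPred_eq, cornerStar_eq_iff]
    exact star_zero M
  smul_mem' c a ha := by
    rw [Set.mem_ofPred_eq, cornerStar_eq_iff] at *
    change star (c • (a : M)) = c • (a : M)
    rw [star_smul, ha, star_trivial]

theorem isClosed_selfAdjointCorner (p : Proj M) :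
    IsClosed (selfAdjointCorner p : Set (corner (p : M) (p : M))) := by
  have : (selfAdjointCorner p : Set (corner (p : M) (p : M))) =
      {h : corner (p : M) (p : M) | star (h : M) = h} := by
    ext h
    exact cornerStar_eq_iff h
  rw [this]
  exact isClosed_eq (continuous_star.comp continuous_subtype_val) continuous_subtype_val

theorem selfAdjointCorner_decomposition (p : Proj M) (v : corner (p : M) (p : M)) :
    ∃! ab : selfAdjointCorner p × selfAdjointCorner p,
      v = (ab.1 : corner (p : M) (p : M)) + Complex.I • (ab.2 : corner (p : M) (p : M)) := by
  have hs : ∀ a : selfAdjointCorner p, star ((a : corner (p : M) (p : M)) : M) = a.1 :=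
    fun a => (cornerStar_eq_iff _).1 a.2
  refine ⟨(⟨(1 / 2 : ℂ) • (v + cornerStar p v), ?_⟩,
    ⟨(-Complex.I / 2) • (v - cornerStar p v), ?_⟩), ?_, ?_⟩
  · refine (cornerStar_eq_iff _).2 ?_
    change star ((1 / 2 : ℂ) • ((v : M) + cornerStar p v)) =
      (1 / 2 : ℂ) • ((v : M) + cornerStar p v)
    rw [cornerStar_coe, star_smul, star_add, star_star, add_comm]
    simp
  · refine (cornerStar_eq_iff _).2 ?_
    change star ((-Complex.I / 2 : ℂ) • ((v : M) - cornerStar p v)) =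
      (-Complex.I / 2 : ℂ) • ((v : M) - cornerStar p v)
    rw [cornerStar_coe, star_smul, star_sub, star_star, ← neg_sub, smul_neg, ← neg_smul]
    congr 1
    simp [neg_div]
  · change v = (1 / 2 : ℂ) • (v + cornerStar p v) +
      Complex.I • (-Complex.I / 2) • (v - cornerStar p v)
    rw [smul_smul, show Complex.I * (-Complex.I / 2) = 1 / 2 by
      rw [mul_div_assoc', mul_neg, Complex.I_mul_I]; simp]
    module
  · rintro ⟨a, b⟩ hab
    have h₁ : (v : M) = ((a.1 : corner (p : M) (p : M)) : M) +
        Complex.I • ((b.1 : corner (p : M) (p : M)) : M) := congrArg Subtype.val hab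
    have h₂ : star (v : M) = ((a.1 : corner (p : M) (p : M)) : M) -
        Complex.I • ((b.1 : corner (p : M) (p : M)) : M) := by
      rw [h₁, star_add, star_smul, hs, hs]
      simp [sub_eq_add_neg]
    refine Prod.ext (Subtype.ext (Subtype.ext ?_)) (Subtype.ext (Subtype.ext ?_))
    · change _ = (1 / 2 : ℂ) • ((v : M) + cornerStar p v)
      rw [cornerStar_coe, h₂, h₁]
      module
    · change _ = (-Complex.I / 2) • ((v : M) - cornerStar p v)
      rw [cornerStar_coe, h₂, h₁, add_sub_sub_cancel, ← two_smul ℂ, smul_smul, smul_smul,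
        show -Complex.I / 2 * 2 * Complex.I = 1 by
          rw [div_mul_cancel₀ _ two_ne_zero, neg_mul, Complex.I_mul_I, neg_neg], one_smul]

/-- With `w` a partial isometry, `x ↦ i (w⋆ x - ι(x) w) / 2` takes `J` to the adjoint, and its
derivative at `w` is `v ↦ i w⋆ v`. -/
theorem isComplexificationOf_arrowsChart (q p : Proj M) :
    IsComplexificationOf {arrowsChart q p} {x | (x : M) ∈ partialIsometries M} := by
  intro w hw
  have hww := isArrow_arrows w
  have hJiff : ∀ x : arrows q p, (x : M) ∈ partialIsometries M ↔ arrowsJ q p x = x := fun x => by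
    rw [mem_partialIsometries_iff x.2.1, Subtype.ext_iff]
    rfl
  have hwi : inversion (w : M) = star (w : M) := by
    have h := congrArg Subtype.val ((hJiff w).1 hw)
    change star (inversion (w : M)) = w at h
    rw [← h, star_star, h]
  rw [hwi] at hww
  let H : (arrowsChart q p).Model → corner (p : M) (p : M) := fun v =>
    compressL p p ((Complex.I / 2) •
      (star (w : M) * arrowsCoord q p v - inversion (arrowsCoord q p v) * w))
  let e : (arrowsChart q p).Model := (arrowsChart q p).toFun w
  have hwe : IsArrow (q : M) p (arrowsCoord q p e) (star (w : M)) := by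
    rw [arrowsCoord_toFun w]
    exact hww
  have hval : ∀ x : arrows q p, IsArrow (q : M) p (arrowsCoord q p ((arrowsChart q p).toFun x))
      (inversion (x : M)) := fun x => by
    rw [arrowsCoord_toFun]
    exact isArrow_arrows x
  have hJc : ∀ x : arrows q p, compressL q p (star (inversion
      (arrowsCoord q p ((arrowsChart q p).toFun x)))) =
      (arrowsChart q p).toFun (arrowsJ q p x) := fun x => by
    rw [arrowsCoord_toFun]
    rfl
  have hinvJ : ∀ x : arrows q p, inversion (arrowsJ q p x : M) = star (x : M) := fun x =>
    (isArrow_arrows x).symm.adjoint.inversion_eq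
  have hA := isBanachAtlas_arrowsChart q p
  have hHx : ∀ x : arrows q p, (H ((arrowsChart q p).toFun x) : M) =
      (Complex.I / 2) • (star (w : M) * x - inversion (x : M) * w) := fun x => by
    change (p : M) * ((Complex.I / 2) • (star (w : M) *
      arrowsCoord q p ((arrowsChart q p).toFun x) - inversion
      (arrowsCoord q p ((arrowsChart q p).toFun x)) * w)) * p = _
    rw [arrowsCoord_toFun, mul_smul_comm, smul_mul_assoc, mul_sub, sub_mul, ← mul_assoc,
      ← mul_assoc, hww.symm.target_mul, (isArrow_arrows x).source_mul, mul_assoc, mul_assoc,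
      (isArrow_arrows x).mul_source, hww.mul_source]
  have hHan : AnalyticAt ℂ H e := by
    have h := analyticAt_inversion ((arrowsCoord q p).analyticAt e)
      arrowsCoord_left arrowsCoord_right hwe
    have h₂ := (arrowsCoord q p).analyticAt e
    have h₃ : AnalyticAt ℂ (fun v => (Complex.I / 2) •
        (star (w : M) * arrowsCoord q p v - inversion (arrowsCoord q p v) * w)) e :=
      (analyticAt_const (v := Complex.I / 2)).smul
        (((analyticAt_const (v := star (w : M))).mul h₂).sub
          (h.mul (analyticAt_const (v := (w : M)))))
    exact ((compressL p p).analyticAt _).comp h₃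
  let D : (arrowsChart q p).Model ≃L[ℂ] corner (p : M) (p : M) := mulArrowEquiv q p hww.symm
  have hD : HasFDerivAt H (D : (arrowsChart q p).Model →L[ℂ] corner (p : M) (p : M)) e := by
    have h := hasFDerivAt_inversion ((arrowsCoord q p).hasFDerivAt (x := e))
      arrowsCoord_left arrowsCoord_right hwe
    have h₁ := (ContinuousLinearMap.mul ℂ M (star (w : M))).hasFDerivAt.comp e
      ((arrowsCoord q p).hasFDerivAt (x := e))
    have h₂ := ((ContinuousLinearMap.mul ℂ M).flip (w : M)).hasFDerivAt.comp e h
    have h₃ := (compressL p p).hasFDerivAt.comp e ((h₁.sub h₂).const_smul (Complex.I / 2))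
    refine h₃.congr_fderiv (ContinuousLinearMap.ext fun v => Subtype.ext ?_)
    refine Eq.trans ?_ (mulArrowEquiv_coe hww.symm v).symm
    change (p : M) * ((Complex.I / 2) • (star (w : M) * arrowsCoord q p v -
      -(star (w : M) * arrowsCoord q p v * star (w : M)) * w)) * p
        = Complex.I • (star (w : M) * arrowsCoord q p v)
    have hv := arrowsCoord_right v
    rw [neg_mul, sub_neg_eq_add, mul_assoc _ _ (w : M), hww.inv_mul,
      mul_assoc (star (w : M)) _ (p : M), hv,
      ← two_smul ℂ, smul_smul, div_mul_cancel₀ _ two_ne_zero, mul_smul_comm,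
      smul_mul_assoc, ← mul_assoc, hww.symm.target_mul, mul_assoc, hv]
  obtain ⟨S, -, hwS, hmax, himg⟩ := exists_straightening_chart (𝕜 := ℂ) hA
    (subset_maximalAtlas hA rfl) (Y := {x | (x : M) ∈ partialIsometries M}) (J := arrowsJ q p)
    (Jc := fun v => compressL q p (star (inversion (arrowsCoord q p v))))
    (H := H) (K := cornerStar p) (x := w) trivial ((hJiff w).1 hw) (fun _ _ => trivial)
    (fun x => Subtype.ext (involutionJ_involutionJ x.2.1)) hJiff (fun x _ => hJc x)
    (fun x _ => by
      have h := (analyticAt_inversion ((arrowsCoord q p).analyticAt _)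
        arrowsCoord_left arrowsCoord_right (hval x)).continuousAt
      exact (compressL q p).continuous.continuousAt.comp h.star)
    (fun x _ => by
      refine Subtype.ext ?_
      rw [cornerStar_coe, hHx, hHx, hinvJ, star_smul, star_sub, star_mul, star_mul, star_star]
      change (Complex.I / 2) • (star (w : M) * star (inversion (x : M)) - _) = _
      rw [← neg_sub, smul_neg, ← neg_smul]
      congr 1
      simp [neg_div]) hHan D hD
  exact ⟨_, hmax, hwS, selfAdjointCorner p, isClosed_selfAdjointCorner p,
    selfAdjointCorner_decomposition p, himg⟩

end Arrows

/-! ### The submanifold of partial isometries -/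

/-- A continuous linear map `(a, z, b) ↦ (a, L (a, z, b), b)` is invertible when `z ↦ L (0, z, 0)`
is. -/
theorem exists_equiv_of_triangular {A Z B H : Type*} [NormedAddCommGroup A] [NormedSpace ℝ A]
    [NormedAddCommGroup Z] [NormedSpace ℝ Z] [NormedAddCommGroup B] [NormedSpace ℝ B]
    [NormedAddCommGroup H] [NormedSpace ℝ H] (f : A × Z × B →L[ℝ] A × H × B) (T : Z ≃L[ℝ] H)
    (h₁ : ∀ v, (f v).1 = v.1) (h₃ : ∀ v, (f v).2.2 = v.2.2)
    (h₂ : ∀ z, (f (0, z, 0)).2.1 = T z) :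
    ∃ D : (A × Z × B) ≃L[ℝ] A × H × B, (D : A × Z × B →L[ℝ] A × H × B) = f := by
  let π : A × H × B →L[ℝ] A × Z × B := (ContinuousLinearMap.fst ℝ A (H × B)).prod
    ((0 : A × H × B →L[ℝ] Z).prod
      ((ContinuousLinearMap.snd ℝ H B).comp (ContinuousLinearMap.snd ℝ A (H × B))))
  let m : A × H × B →L[ℝ] H :=
    (ContinuousLinearMap.fst ℝ H B).comp (ContinuousLinearMap.snd ℝ A (H × B))
  let g : A × H × B →L[ℝ] A × Z × B := (ContinuousLinearMap.fst ℝ A (H × B)).prod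
    (((T.symm : H →L[ℝ] Z).comp (m - m.comp (f.comp π))).prod
      ((ContinuousLinearMap.snd ℝ H B).comp (ContinuousLinearMap.snd ℝ A (H × B))))
  have hg : ∀ w, g w = (w.1, T.symm (w.2.1 - (f (w.1, 0, w.2.2)).2.1), w.2.2) := fun w => rfl
  have hf : ∀ v : A × Z × B, (f v).2.1 = (f (v.1, 0, v.2.2)).2.1 + T v.2.1 := fun v => by
    have : v = (v.1, 0, v.2.2) + (0, v.2.1, 0) := by simp
    conv_lhs => rw [this]
    rw [map_add, ← h₂]
    rfl
  refine ⟨ContinuousLinearEquiv.equivOfInverse f g (fun v => ?_) (fun w => ?_), rfl⟩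
  · rw [hg, h₁, h₃, hf v, add_sub_cancel_left, T.symm_apply_apply]
  · refine Prod.ext (h₁ _) (Prod.ext ?_ (h₃ _))
    rw [hf, hg]
    simp

variable {q p : Proj M}

/-- The involution `J` of the groupoid. -/
noncomputable def groupoidJ (x : partiallyInvertible M) : partiallyInvertible M :=
  ⟨involutionJ (x : M), involutionJ_mem x.2⟩

theorem groupoidJ_groupoidJ (x : partiallyInvertible M) : groupoidJ (groupoidJ x) = x :=
  Subtype.ext (involutionJ_involutionJ x.2)

theorem mem_unitaryPart_iff (x : partiallyInvertible M) :
    x ∈ unitaryPart M ↔ groupoidJ x = x := by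
  rw [Subtype.ext_iff]
  exact mem_partialIsometries_iff x.2

theorem leftSupport_groupoidJ (x : partiallyInvertible M) :
    leftSupport (groupoidJ x : M) = leftSupport (x : M) :=
  Subtype.ext (isArrow_involutionJ x.2).leftSupport_coe

theorem rightSupport_groupoidJ (x : partiallyInvertible M) :
    rightSupport (groupoidJ x : M) = rightSupport (x : M) :=
  Subtype.ext (isArrow_involutionJ x.2).rightSupport_coe

theorem groupoidJ_mem_chartDomain {x : partiallyInvertible M} (hx : x ∈ chartDomain q p) :
    groupoidJ x ∈ chartDomain q p := by
  refine ⟨?_, ?_⟩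
  · rw [leftSupport_groupoidJ]
    exact hx.1
  · rw [rightSupport_groupoidJ]
    exact hx.2

/-- The involution `J` keeps the outer coordinates `y'`, `y` and moves the middle one to
`q ι(q + y')⋆ ι(z)⋆ (p + y)⋆ (p + y)`. -/
noncomputable def middleJ (q p : Proj M) (e : (groupoidChart q p).Model) : M :=
  q * star (graphInv (q : M) (coordL₁ q p e)) * star (inversion (coordL₂ q p e)) *
    (star (p + coordL₃ q p e) * (p + coordL₃ q p e))

theorem coordL₂_groupoidJ {x : partiallyInvertible M} (hx : x ∈ chartDomain q p) :
    coordL₂ q p ((groupoidChart q p).toFun (groupoidJ x)) =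
      middleJ q p ((groupoidChart q p).toFun x) := by
  have h₁ := groupoidChart_middle (groupoidJ_mem_chartDomain hx)
  have h₂ := chartPointInv_groupoidChart hx
  rw [rightSupport_groupoidJ] at h₁
  refine h₁.trans ?_
  change (q : M) * star (inversion (x : M)) * (p + coordL₃ q p ((groupoidChart q p).toFun x)) = _
  rw [← h₂]
  rw [chartPointInv, star_mul, star_mul, middleJ]
  simp only [mul_assoc]
  rfl

theorem groupoidChart_groupoidJ {x : partiallyInvertible M} (hx : x ∈ chartDomain q p) :
    (groupoidChart q p).toFun (groupoidJ x) = (((groupoidChart q p).toFun x).1,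
      compressL q p (middleJ q p ((groupoidChart q p).toFun x)),
      ((groupoidChart q p).toFun x).2.2) := by
  refine Prod.ext ?_ (Prod.ext ?_ ?_)
  · change projCoord q (leftSupport (groupoidJ x : M)) = projCoord q (leftSupport (x : M))
    rw [leftSupport_groupoidJ]
  · rw [← coordL₂_groupoidJ hx]
    exact (compress_self _).symm
  · change projCoord p (rightSupport (groupoidJ x : M)) = projCoord p (rightSupport (x : M))
    rw [rightSupport_groupoidJ]

/-- The model space of the straightened charts: its middle summand is `p M p` instead of `q M p`. -/
abbrev StraightModel (q p : Proj M) : Type u :=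
  corner (1 - (q : M)) (q : M) × corner (p : M) (p : M) × corner (1 - (p : M)) (p : M)

/-- The middle coordinate `i (k z - (k ẑ)⋆) / 2`, where `ẑ` is the middle coordinate of `J x`. -/
noncomputable def straightMiddle (q p : Proj M) (k : M) (e : (groupoidChart q p).Model) : M :=
  (Complex.I / 2) • (k * coordL₂ q p e - star (k * middleJ q p e))

/-- The function of the coordinates which straightens the fixed points of `J`, for `k` in `p M q`:
it only changes the middle coordinate. -/
noncomputable def straighten (q p : Proj M) (k : M) (e : (groupoidChart q p).Model) :
    StraightModel q p :=
  (e.1, compressL p p (straightMiddle q p k e), e.2.2)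

/-- The adjoint of the middle coordinate. -/
noncomputable def straightStar (q p : Proj M) (e : StraightModel q p) : StraightModel q p :=
  (e.1, cornerStar p e.2.1, e.2.2)

theorem straighten_groupoidJ (k : M) {x : partiallyInvertible M} (hx : x ∈ chartDomain q p) :
    straighten q p k ((groupoidChart q p).toFun (groupoidJ x)) =
      straightStar q p (straighten q p k ((groupoidChart q p).toFun x)) := by
  have hJ := groupoidJ_mem_chartDomain hx
  have hm : straightMiddle q p k ((groupoidChart q p).toFun (groupoidJ x)) =
      star (straightMiddle q p k ((groupoidChart q p).toFun x)) := by
    rw [straightMiddle, straightMiddle, ← coordL₂_groupoidJ hx, ← coordL₂_groupoidJ hJ,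
      groupoidJ_groupoidJ, star_smul, star_sub, star_star, ← neg_sub, smul_neg, ← neg_smul]
    congr 1
    simp [neg_div]
  refine Prod.ext ?_ (Prod.ext (Subtype.ext ?_) ?_)
  · change ((groupoidChart q p).toFun (groupoidJ x)).1 = _
    rw [groupoidChart_groupoidJ hx]
    rfl
  · change (compressL p p (straightMiddle q p k _) : M) = cornerStar p (compressL p p _)
    rw [hm, cornerStar_coe, compressL_coe, compressL_coe, star_mul, star_mul, p.2.2.star_eq,
      mul_assoc]
  · change ((groupoidChart q p).toFun (groupoidJ x)).2.2 = _
    rw [groupoidChart_groupoidJ hx]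
    rfl

/-- `coordL₁` as a real linear map on the underlying real model space. -/
noncomputable def coordR₁ (q p : Proj M) : (groupoidChart q p).toReal.Model →L[ℝ] M :=
  (coordL₁ q p).restrictScalars ℝ

/-- `coordL₂` as a real linear map on the underlying real model space. -/
noncomputable def coordR₂ (q p : Proj M) : (groupoidChart q p).toReal.Model →L[ℝ] M :=
  (coordL₂ q p).restrictScalars ℝ

/-- `coordL₃` as a real linear map on the underlying real model space. -/
noncomputable def coordR₃ (q p : Proj M) : (groupoidChart q p).toReal.Model →L[ℝ] M :=
  (coordL₃ q p).restrictScalars ℝ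

theorem analyticAt_middleJ {x : partiallyInvertible M} (hx : x ∈ chartDomain q p) :
    AnalyticAt ℝ (fun e : (groupoidChart q p).toReal.Model => middleJ q p e)
      ((groupoidChart q p).toReal.toFun x) := by
  set e := (groupoidChart q p).toReal.toFun x with he
  have h₁ : AnalyticAt ℝ (fun v => star (graphInv (q : M) (coordR₁ q p v))) e :=
    analyticAt_star_comp
      ((analyticAt_graphInv (q : M) (coordR₁ q p e)).comp ((coordR₁ q p).analyticAt e))
  have h₂ : AnalyticAt ℝ (fun v => star (inversion (coordR₂ q p v))) e :=
    analyticAt_star_comp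
      (analyticAt_inversion (g := coordR₂ q p) ((coordR₂ q p).analyticAt e) coordL₂_left
        coordL₂_right (isArrow_groupoidChart_middle hx))
  have h₃ : AnalyticAt ℝ (fun v => (p : M) + coordR₃ q p v) e :=
    analyticAt_const.add ((coordR₃ q p).analyticAt e)
  have h₄ : AnalyticAt ℝ (fun v => star ((p : M) + coordR₃ q p v)) e :=
    analyticAt_star_comp h₃
  exact (((analyticAt_const (v := (q : M))).mul h₁).mul h₂).mul (h₄.mul h₃)

theorem analyticAt_straighten (k : M) {x : partiallyInvertible M} (hx : x ∈ chartDomain q p) :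
    AnalyticAt ℝ (fun e : (groupoidChart q p).toReal.Model => straighten q p k e)
      ((groupoidChart q p).toReal.toFun x) := by
  set e := (groupoidChart q p).toReal.toFun x with he
  have h₁ : AnalyticAt ℝ (fun v => star (k * middleJ q p v)) e :=
    analyticAt_star_comp ((analyticAt_const (v := k)).mul (analyticAt_middleJ hx))
  have h₂ : AnalyticAt ℝ (fun v => (Complex.I / 2) •
      (k * coordR₂ q p v - star (k * middleJ q p v))) e :=
    ((Complex.I / 2) • ContinuousLinearMap.id ℝ M).analyticAt _ |>.comp
      (((analyticAt_const (v := k)).mul ((coordR₂ q p).analyticAt e)).sub h₁)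
  have l₁ : AnalyticAt ℝ (fun v : (groupoidChart q p).toReal.Model => v.1) e :=
    ((ContinuousLinearMap.fst ℂ (corner (1 - (q : M)) (q : M))
      (corner (q : M) (p : M) × corner (1 - (p : M)) (p : M))).restrictScalars ℝ).analyticAt e
  have l₃ : AnalyticAt ℝ (fun v : (groupoidChart q p).toReal.Model => v.2.2) e :=
    (((ContinuousLinearMap.snd ℂ (corner (q : M) (p : M)) (corner (1 - (p : M)) (p : M))).comp
      (ContinuousLinearMap.snd ℂ (corner (1 - (q : M)) (q : M))
        (corner (q : M) (p : M) × corner (1 - (p : M)) (p : M)))).restrictScalars ℝ).analyticAt e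
  exact l₁.prod (((((compressL p p).restrictScalars ℝ).analyticAt _).comp h₂).prod l₃)

/-- At coordinates `(y', z, y)`, the element `k = z⋆ (q + y')⋆ (q + y')` is an arrow from `q` to
`p`. -/
theorem isArrow_straightener {x : partiallyInvertible M} (hx : x ∈ chartDomain q p) :
    ∃ t, IsArrow (p : M) q (star (coordL₂ q p ((groupoidChart q p).toFun x)) *
      (star (q + coordL₁ q p ((groupoidChart q p).toFun x)) *
        (q + coordL₁ q p ((groupoidChart q p).toFun x)))) t := by
  have hz := isArrow_groupoidChart_middle hx
  have hs := isArrow_graph q.2 (coordL₁_mem ((groupoidChart q p).toFun x))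
  exact ⟨_, hz.adjoint.comp (hs.adjoint.comp hs)⟩

/-- The vector `(0, w, 0)` of the model space. -/
noncomputable def middleVec (q p : Proj M) (w : corner (q : M) (p : M)) :
    (groupoidChart q p).Model :=
  ((0, w, 0) : corner (1 - (q : M)) (q : M) × corner (q : M) (p : M) ×
    corner (1 - (p : M)) (p : M))

/-- At a fixed point of `J` the derivative of the middle coordinate in the direction of `z` is
`i k`: the two terms contribute equally. -/
theorem hasDerivAt_straightMiddle {x : partiallyInvertible M} (hx : x ∈ chartDomain q p)
    (hJ : groupoidJ x = x) {k : M}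
    (hk : k = star (coordL₂ q p ((groupoidChart q p).toFun x)) *
      (star (q + coordL₁ q p ((groupoidChart q p).toFun x)) *
        (q + coordL₁ q p ((groupoidChart q p).toFun x)))) (w : corner (q : M) (p : M)) :
    HasDerivAt (fun t : ℝ => straightMiddle q p k
      ((groupoidChart q p).toFun x + (t : ℂ) • middleVec q p w))
      (Complex.I • (k * w)) 0 := by
  set e := (groupoidChart q p).toFun x with he
  set a := coordL₁ q p e with ha
  set z := coordL₂ q p e with hz
  set b := coordL₃ q p e with hb
  set B : M := star (p + b) * (p + b) with hB
  set gi := graphInv (q : M) a with hgi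
  have hza : IsArrow (q : M) p z (inversion z) := by
    have := isArrow_groupoidChart_middle hx
    have h' := this.inversion_eq
    rw [← h'] at this
    exact this
  have hga : IsArrow ((q + a) * gi) q (q + a) gi := isArrow_graph q.2 (coordL₁_mem e)
  have hqa : (q : M) * (q + a) = q := by
    rw [mul_add, q.2.1.eq, proj_mul_of_mem_corner q.2 (coordL₁_mem e), add_zero]
  have haq : star (q + a) * (q : M) = q := by
    have := congrArg star hqa
    rwa [star_mul, q.2.2.star_eq] at this
  -- `ι(q + a) q` inverts `(q + a)⋆ (q + a)` on the left in the corner of `q`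
  have hgA : gi * q * (star (q + a) * (q + a)) = q := by
    have h₁ : star (q + a) * ((q + a) * gi) = star (q + a) := hga.adjoint.mul_source
    have h₂ : (q + a) * gi * q * star (q + a) = (q + a) * gi := by
      have hol := hga.isOblique hqa
      have h₃ := congrArg star hol.mul_target
      rw [star_mul, hga.star_target] at h₃
      have h₄ := congrArg star hga.mul_source
      rw [star_mul, q.2.2.star_eq] at h₄
      rw [mul_assoc, h₄, h₃]
    calc gi * q * (star (q + a) * (q + a))
        = gi * ((q + a) * gi * q * star (q + a)) * (q + a) := by
          simp only [← mul_assoc]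
          rw [hga.inv_mul, hga.source_mul]
      _ = q := by rw [h₂, ← mul_assoc, hga.inv_mul, hga.source_mul, hga.inv_mul]
  have hfix : (q : M) * star gi * star (inversion z) * B = z := by
    have h := coordL₂_groupoidJ hx
    rw [hJ] at h
    exact h.symm
  have hBs : star B = B := by rw [hB, star_mul, star_star]
  have hk' : k = B * inversion z := by
    have h := congrArg star hfix
    simp only [star_mul, star_star, hBs, q.2.2.star_eq] at h
    rw [hk, ← h]
    calc B * (inversion z * (gi * q)) * (star (q + a) * (q + a))
        = B * (inversion z * (gi * q * (star (q + a) * (q + a)))) := by simp only [mul_assoc]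
      _ = B * inversion z := by rw [hgA, hza.mul_target]
  have hks : inversion z * gi * q * star k = p := by
    rw [hk]
    simp only [star_mul, star_star]
    calc inversion z * gi * q * (star (q + a) * (q + a) * z)
        = inversion z * (gi * q * (star (q + a) * (q + a))) * z := by simp only [mul_assoc]
      _ = p := by rw [hgA, hza.mul_target, hza.inv_mul]
  have hline : HasDerivAt (fun t : ℝ => z + (t : ℂ) • (w : M)) (w : M) 0 := by
    have h₁ : HasDerivAt (fun t : ℝ => (t : ℂ)) 1 0 := by
      simpa using (hasDerivAt_id (0 : ℝ)).ofReal_comp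
    have := (h₁.smul_const (w : M)).const_add z
    simpa using this
  have hl : ∀ t : ℝ, (q : M) * (z + (t : ℂ) • (w : M)) = z + (t : ℂ) • (w : M) := fun t => by
    rw [mul_add, mul_smul_comm, corner_left, hza.target_mul]
  have hr : ∀ t : ℝ, (z + (t : ℂ) • (w : M)) * p = z + (t : ℂ) • (w : M) := fun t => by
    rw [add_mul, smul_mul_assoc, corner_right, hza.mul_source]
  have hz0 : IsArrow (q : M) p (z + ((0 : ℝ) : ℂ) • (w : M)) (inversion z) := by simpa using hza
  have hinv : HasDerivAt (fun t : ℝ => inversion (z + (t : ℂ) • (w : M)))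
      (-(inversion z * w * inversion z)) 0 := by
    have := (hasFDerivAt_inversion hline.hasFDerivAt hl hr hz0).hasDerivAt
    simpa using this
  have hstar : HasDerivAt (fun t : ℝ => star (inversion (z + (t : ℂ) • (w : M))))
      (star (-(inversion z * w * inversion z))) 0 := hinv.star
  have h₁ : HasDerivAt (fun t : ℝ => star (k * ((q : M) * star gi *
      star (inversion (z + (t : ℂ) • (w : M))) * B)))
      (star (k * ((q : M) * star gi * star (-(inversion z * w * inversion z)) * B))) 0 :=
    (((hstar.const_mul ((q : M) * star gi)).mul_const B).const_mul k).star
  have h₂ := ((hline.const_mul k).sub h₁).const_smul (Complex.I / 2)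
  have hfun : ∀ t : ℝ, straightMiddle q p k (e + (t : ℂ) • middleVec q p w)
      = (Complex.I / 2) • (k * (z + (t : ℂ) • (w : M)) - star (k * ((q : M) * star gi *
      star (inversion (z + (t : ℂ) • (w : M))) * B))) := by
    intro t
    have e₁ : coordL₁ q p (e + (t : ℂ) • middleVec q p w) = a := by
      rw [map_add, map_smul, show coordL₁ q p (middleVec q p w) = 0 from rfl,
        smul_zero, add_zero]
    have e₂ : coordL₂ q p (e + (t : ℂ) • middleVec q p w) =
        z + (t : ℂ) • (w : M) := by
      rw [map_add, map_smul]
      rfl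
    have e₃ : coordL₃ q p (e + (t : ℂ) • middleVec q p w) = b := by
      rw [map_add, map_smul, show coordL₃ q p (middleVec q p w) = 0 from rfl,
        smul_zero, add_zero]
    rw [straightMiddle, middleJ, e₁, e₂, e₃]
  have hval : (Complex.I / 2) • (k * (w : M) -
      star (k * ((q : M) * star gi * star (-(inversion z * w * inversion z)) * B))) =
      Complex.I • (k * (w : M)) := by
    have : star (k * ((q : M) * star gi * star (-(inversion z * w * inversion z)) * B)) =
        -(k * w) := by
      simp only [star_mul, star_star, hBs, q.2.2.star_eq]
      calc B * (-(inversion z * w * inversion z) * (gi * q)) * star k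
          = -(B * inversion z * (w * (inversion z * gi * q * star k))) := by
            simp only [neg_mul, mul_neg, mul_assoc]
        _ = -(k * w) := by rw [hks, corner_right, ← hk']
    rw [this, sub_neg_eq_add, ← two_smul ℂ, smul_smul, div_mul_cancel₀ _ two_ne_zero]
  rw [← hval]
  exact h₂.congr_of_eventuallyEq (Eventually.of_forall hfun)

/-- The straightening function has an invertible derivative at a fixed point of `J`. -/
theorem exists_straighten_deriv {x : partiallyInvertible M} (hx : x ∈ chartDomain q p)
    (hJ : groupoidJ x = x) :
    ∃ (k : M) (D : (groupoidChart q p).toReal.Model ≃L[ℝ] StraightModel q p),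
      HasFDerivAt (fun e : (groupoidChart q p).toReal.Model => straighten q p k e)
        (D : (groupoidChart q p).toReal.Model →L[ℝ] StraightModel q p)
        ((groupoidChart q p).toReal.toFun x) := by
  obtain ⟨t, hk⟩ := isArrow_straightener hx
  set k := star (coordL₂ q p ((groupoidChart q p).toFun x)) *
      (star (q + coordL₁ q p ((groupoidChart q p).toFun x)) *
        (q + coordL₁ q p ((groupoidChart q p).toFun x))) with hkdef
  refine ⟨k, ?_⟩
  have hf := (analyticAt_straighten k hx).differentiableAt.hasFDerivAt
  set f := fderiv ℝ (fun e : (groupoidChart q p).toReal.Model => straighten q p k e)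
    ((groupoidChart q p).toReal.toFun x) with hfdef
  let π₁ : (groupoidChart q p).toReal.Model →L[ℝ] corner (1 - (q : M)) (q : M) :=
    (ContinuousLinearMap.fst ℂ (corner (1 - (q : M)) (q : M))
      (corner (q : M) (p : M) × corner (1 - (p : M)) (p : M))).restrictScalars ℝ
  let π₃ : (groupoidChart q p).toReal.Model →L[ℝ] corner (1 - (p : M)) (p : M) :=
    ((ContinuousLinearMap.snd ℂ (corner (q : M) (p : M)) (corner (1 - (p : M)) (p : M))).comp
      (ContinuousLinearMap.snd ℂ (corner (1 - (q : M)) (q : M))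
        (corner (q : M) (p : M) × corner (1 - (p : M)) (p : M)))).restrictScalars ℝ
  have h₁ : ∀ v, (f v).1 = π₁ v := fun v => by
    have h := (hf.fst).unique (π₁.hasFDerivAt (x := (groupoidChart q p).toReal.toFun x))
    exact DFunLike.congr_fun h v
  have h₃ : ∀ v, (f v).2.2 = π₃ v := fun v => by
    have h := (hf.snd.snd).unique (π₃.hasFDerivAt (x := (groupoidChart q p).toReal.toFun x))
    exact DFunLike.congr_fun h v
  let T : corner (q : M) (p : M) ≃L[ℝ] corner (p : M) (p : M) :=
    ContinuousLinearEquiv.equivOfInverse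
      ((mulArrowEquiv q p hk : corner (q : M) (p : M) →L[ℂ] corner (p : M) (p : M)).restrictScalars
        ℝ)
      (((mulArrowEquiv q p hk).symm :
        corner (p : M) (p : M) →L[ℂ] corner (q : M) (p : M)).restrictScalars ℝ)
      (fun z => (mulArrowEquiv q p hk).symm_apply_apply z)
      (fun z => (mulArrowEquiv q p hk).apply_symm_apply z)
  have h₂ : ∀ w : corner (q : M) (p : M),
      (f (middleVec q p w)).2.1 = T w := fun w => by
    let u : (groupoidChart q p).toReal.Model := middleVec q p w
    have hl : HasDerivAt (fun t : ℝ => (groupoidChart q p).toReal.toFun x + t • u) u 0 := by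
      have := ((hasDerivAt_id (0 : ℝ)).smul_const u).const_add
        ((groupoidChart q p).toReal.toFun x)
      simpa using this
    have hf0 : HasFDerivAt (fun e : (groupoidChart q p).toReal.Model => straighten q p k e) f
        ((groupoidChart q p).toReal.toFun x + (0 : ℝ) • u) := by
      rw [zero_smul, add_zero]
      exact hf
    have hc := hf0.snd.fst.comp_hasDerivAt (0 : ℝ) hl
    have hd := ((compressL p p).restrictScalars ℝ).hasFDerivAt.comp_hasDerivAt (0 : ℝ)
      (hasDerivAt_straightMiddle hx hJ hkdef w)
    have huniq := hc.unique hd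
    refine huniq.trans (Subtype.ext ?_)
    refine Eq.trans ?_ (mulArrowEquiv_coe hk w).symm
    change (p : M) * (Complex.I • (k * w)) * p = _
    rw [mul_smul_comm, smul_mul_assoc, ← mul_assoc, hk.target_mul, mul_assoc, corner_right]
  obtain ⟨D, hD⟩ := exists_equiv_of_triangular (A := corner (1 - (q : M)) (q : M))
    (Z := corner (q : M) (p : M)) (B := corner (1 - (p : M)) (p : M))
    (H := corner (p : M) (p : M)) f T h₁ h₃ h₂
  refine ⟨D, ?_⟩
  have : HasFDerivAt (fun e : (groupoidChart q p).toReal.Model => straighten q p k e) f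
    ((groupoidChart q p).toReal.toFun x) := hf
  rw [← hD] at this
  exact this

/-- The inclusion of `p Mʰ p` in `p M p`. -/
noncomputable def hermIncl (p : Proj M) : hermCorner p →L[ℝ] corner (p : M) (p : M) where
  toFun h := ⟨h, h.2.1⟩
  map_add' _ _ := rfl
  map_smul' _ _ := rfl
  cont := continuous_subtype_val.subtype_mk _

/-- The self-adjoint part, as a projection of `p M p` onto `p Mʰ p`. -/
noncomputable def hermPart (p : Proj M) : corner (p : M) (p : M) →L[ℝ] hermCorner p where
  toFun h := ⟨(1 / 2 : ℝ) • ((h : M) + star (h : M)), by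
    have hs : (p : M) * star (h : M) * p = star (h : M) := by
      rw [← cornerStar_coe]
      exact (cornerStar p h).2
    have hh : (p : M) * h * p = h := h.2
    refine ⟨?_, ?_⟩
    · rw [mul_smul_comm, smul_mul_assoc, mul_add, add_mul, hs, hh]
    · rw [IsSelfAdjoint, star_smul, star_add, star_star, add_comm, star_trivial]⟩
  map_add' a b := Subtype.ext (by
    change (1 / 2 : ℝ) • ((a : M) + b + star ((a : M) + b)) =
      (1 / 2 : ℝ) • ((a : M) + star (a : M)) + (1 / 2 : ℝ) • ((b : M) + star (b : M))
    rw [star_add]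
    module)
  map_smul' c a := Subtype.ext (by
    change (1 / 2 : ℝ) • (c • (a : M) + star (c • (a : M))) =
      c • (1 / 2 : ℝ) • ((a : M) + star (a : M))
    rw [star_smul, star_trivial]
    module)
  cont := by
    refine Continuous.subtype_mk ?_ _
    have h : Continuous (fun h : corner (p : M) (p : M) => (h : M)) := continuous_subtype_val
    exact (h.add h.star).const_smul _

theorem hermPart_hermIncl (h : hermCorner p) : hermPart p (hermIncl p h) = h := by
  refine Subtype.ext ?_
  change (1 / 2 : ℝ) • ((h : M) + star (h : M)) = h
  rw [h.2.2.star_eq]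
  module

theorem hermIncl_hermPart {h : corner (p : M) (p : M)} (hh : cornerStar p h = h) :
    hermIncl p (hermPart p h) = h := by
  refine Subtype.ext ?_
  change (1 / 2 : ℝ) • ((h : M) + star (h : M)) = h
  rw [(cornerStar_eq_iff h).1 hh]
  module

/-- The inclusion of the model space of the partial isometries. -/
noncomputable def modelIncl (q p : Proj M) : UnitaryModel q p →L[ℝ] StraightModel q p :=
  (ContinuousLinearMap.id ℝ _).prodMap ((hermIncl p).prodMap (ContinuousLinearMap.id ℝ _))

/-- The projection onto the model space of the partial isometries. -/
noncomputable def modelProj (q p : Proj M) : StraightModel q p →L[ℝ] UnitaryModel q p :=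
  (ContinuousLinearMap.id ℝ _).prodMap ((hermPart p).prodMap (ContinuousLinearMap.id ℝ _))

theorem modelProj_modelIncl (v : UnitaryModel q p) : modelProj q p (modelIncl q p v) = v :=
  Prod.ext rfl (Prod.ext (hermPart_hermIncl v.2.1) rfl)

theorem modelIncl_modelProj {e : StraightModel q p} (he : straightStar q p e = e) :
    modelIncl q p (modelProj q p e) = e :=
  Prod.ext rfl (Prod.ext (hermIncl_hermPart (congrArg (fun e => e.2.1) he)) rfl)

theorem range_modelIncl : Set.range (modelIncl q p) = {e | straightStar q p e = e} := by
  ext e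
  constructor
  · rintro ⟨v, rfl⟩
    exact Prod.ext rfl (Prod.ext ((cornerStar_eq_iff _).2 v.2.1.2.2) rfl)
  · intro he
    exact ⟨_, modelIncl_modelProj he⟩

theorem isClosed_range_of_leftInverse {E F : Type*} [NormedAddCommGroup E] [NormedSpace ℝ E]
    [NormedAddCommGroup F] [NormedSpace ℝ F] (j : E →L[ℝ] F) (P : F →L[ℝ] E)
    (h : ∀ v, P (j v) = v) :
    IsClosed (Set.range j) ∧ (LinearMap.range j.toLinearMap).ClosedComplemented := by
  constructor
  · have : Set.range j = {v | j (P v) = v} := by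
      ext v
      constructor
      · rintro ⟨w, rfl⟩
        change j (P (j w)) = j w
        rw [h]
      · intro hv
        exact ⟨_, hv⟩
    rw [this]
    exact isClosed_eq (j.continuous.comp P.continuous) continuous_id
  · refine ⟨(j.comp P).codRestrict _ fun v => LinearMap.mem_range_self _ _, ?_⟩
    rintro ⟨_, w, rfl⟩
    refine Subtype.ext ?_
    change j (P (j w)) = j w
    rw [h]

/-- Around a partial isometry in `Ω_{q p}` there is an induced chart, with a domain in `Ω_{q p}`,
modelled on `(1 - q) M q ⊕ p Mʰ p ⊕ (1 - p) M p`. -/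
theorem exists_inducedChart (hqp : ProjEquiv q p) (x : unitaryPart M)
    (hx : (x : partiallyInvertible M) ∈ chartDomain q p) :
    ∃ d ∈ inducedCharts (realAtlas (groupoidAtlas M)) (unitaryPart M),
      x ∈ d.source ∧ d.source ⊆ Subtype.val ⁻¹' chartDomain q p ∧
        Nonempty (d.Model ≃L[ℝ] UnitaryModel q p) := by
  have hA : IsBanachAtlas (realAtlas (groupoidAtlas M)) := isBanachAtlas_groupoidAtlas.realAtlas
  have hxJ : groupoidJ (x : partiallyInvertible M) = x := (mem_unitaryPart_iff _).1 x.2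
  obtain ⟨k, D, hD⟩ := exists_straighten_deriv hx hxJ
  have hc : (groupoidChart q p).toReal ∈ maximalAtlas (realAtlas (groupoidAtlas M)) :=
    subset_maximalAtlas hA ⟨_, ⟨q, p, hqp, rfl⟩, rfl⟩
  obtain ⟨S, hS, hxS, hmax, himg⟩ := exists_straightening_chart hA hc (Y := unitaryPart M)
    (J := groupoidJ)
    (Jc := fun e => (e.1, compressL q p (middleJ q p e), e.2.2))
    (K := straightStar q p) hx hxJ (fun y hy => groupoidJ_mem_chartDomain hy)
    groupoidJ_groupoidJ mem_unitaryPart_iff (fun y hy => (groupoidChart_groupoidJ hy).symm)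
    (fun y hy => by
      have h := (compressL q p).continuous.continuousAt.comp
        (analyticAt_middleJ hy).continuousAt
      exact ContinuousAt.prodMk continuous_fst.continuousAt
        (ContinuousAt.prodMk h (continuous_snd.comp continuous_snd).continuousAt))
    (fun y hy => straighten_groupoidJ k hy) (analyticAt_straighten k hx) D hD
  have hrange := isClosed_range_of_leftInverse (modelIncl q p) (modelProj q p)
    modelProj_modelIncl
  refine ⟨{ Model := UnitaryModel q p
            source := Subtype.val ⁻¹' S
            toFun := fun y => modelProj q p (straighten q p k
              ((groupoidChart q p).toFun (y : partiallyInvertible M))) },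
    ⟨_, hmax, modelIncl q p, Function.LeftInverse.injective modelProj_modelIncl, hrange.1,
      hrange.2, rfl, ?_, ?_⟩, hxS, fun y hy => hS hy, ⟨ContinuousLinearEquiv.refl ℝ _⟩⟩
  · intro y hy
    refine modelIncl_modelProj ?_
    rw [← straighten_groupoidJ k (hS hy), (mem_unitaryPart_iff _).1 y.2]
  · rw [range_modelIncl]
    exact himg

end WStarGroupoid

theorem mainTheorem2 {M : Type u} [CStarAlgebra M] [WStarAlgebra M] :
    -- the complex Banach manifold of partially invertible elements
    BanachManifold.IsBanachAtlas (WStarGroupoid.groupoidAtlas M) ∧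
    -- the partial isometries are the fixed points of the involution `J`
    (∀ x ∈ WStarGroupoid.partiallyInvertible M,
      WStarGroupoid.involutionJ x ∈ WStarGroupoid.partiallyInvertible M ∧
      WStarGroupoid.involutionJ (WStarGroupoid.involutionJ x) = x) ∧
    {x ∈ WStarGroupoid.partiallyInvertible M | WStarGroupoid.involutionJ x = x} =
      WStarGroupoid.partialIsometries M ∧
    -- they form a closed submanifold of the underlying real Banach manifold
    @IsClosed _ (BanachManifold.atlasTopology
      (BanachManifold.realAtlas (WStarGroupoid.groupoidAtlas M))) (WStarGroupoid.unitaryPart M) ∧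
    BanachManifold.IsSubmanifold (BanachManifold.realAtlas (WStarGroupoid.groupoidAtlas M))
      (WStarGroupoid.unitaryPart M) ∧
    -- the induced real Banach manifold structure has the stated type
    (∃ B : Set (BanachManifold.CoordMap ℝ (WStarGroupoid.unitaryPart M)),
      B ⊆ BanachManifold.inducedCharts
        (BanachManifold.realAtlas (WStarGroupoid.groupoidAtlas M))
        (WStarGroupoid.unitaryPart M) ∧
      BanachManifold.IsBanachAtlas B ∧
      (∀ c ∈ B, ∃ q p : WStarGroupoid.Proj M, WStarGroupoid.ProjEquiv q p ∧
        c.source ⊆ Subtype.val ⁻¹' WStarGroupoid.chartDomain q p ∧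
        Nonempty (c.Model ≃L[ℝ] WStarGroupoid.UnitaryModel q p)) ∧
      (∀ q p : WStarGroupoid.Proj M, WStarGroupoid.ProjEquiv q p →
        ∀ x : WStarGroupoid.unitaryPart M,
        (x : WStarGroupoid.partiallyInvertible M) ∈ WStarGroupoid.chartDomain q p →
        ∃ c ∈ B, x ∈ c.source ∧
          c.source ⊆ Subtype.val ⁻¹' WStarGroupoid.chartDomain q p ∧
          Nonempty (c.Model ≃L[ℝ] WStarGroupoid.UnitaryModel q p))) ∧
    -- arrow space by arrow space, the partially invertible elements complexify the
    -- partial isometries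
    (∀ q p : WStarGroupoid.Proj M,
      BanachManifold.IsBanachAtlas {WStarGroupoid.arrowsChart q p} ∧
      BanachManifold.IsComplexificationOf {WStarGroupoid.arrowsChart q p}
        {x | (x : M) ∈ WStarGroupoid.partialIsometries M}) := by
  have hchart : ∀ q p : WStarGroupoid.Proj M, WStarGroupoid.ProjEquiv q p →
      ∀ x : WStarGroupoid.unitaryPart M,
      (x : WStarGroupoid.partiallyInvertible M) ∈ WStarGroupoid.chartDomain q p → _ :=
    fun q p hqp x hx => WStarGroupoid.exists_inducedChart hqp x hx
  have hpair : ∀ x : WStarGroupoid.unitaryPart M, ∃ q p : WStarGroupoid.Proj M,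
      WStarGroupoid.ProjEquiv q p ∧
        (x : WStarGroupoid.partiallyInvertible M) ∈ WStarGroupoid.chartDomain q p :=
    fun x => ⟨_, _, ⟨_, x.1.2, rfl, rfl⟩, WStarGroupoid.mem_chartDomain_self x.1⟩
  refine ⟨WStarGroupoid.isBanachAtlas_groupoidAtlas,
    fun x hx => ⟨WStarGroupoid.involutionJ_mem hx, WStarGroupoid.involutionJ_involutionJ hx⟩,
    WStarGroupoid.setOf_involutionJ_eq, WStarGroupoid.isClosed_unitaryPart, fun x => ?_,
    ⟨{d | d ∈ BanachManifold.inducedCharts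
        (BanachManifold.realAtlas (WStarGroupoid.groupoidAtlas M)) (WStarGroupoid.unitaryPart M) ∧
        ∃ q p : WStarGroupoid.Proj M, WStarGroupoid.ProjEquiv q p ∧
        d.source ⊆ Subtype.val ⁻¹' WStarGroupoid.chartDomain q p ∧
        Nonempty (d.Model ≃L[ℝ] WStarGroupoid.UnitaryModel q p)}, fun d hd => hd.1, ?_,
      fun d hd => hd.2, fun q p hqp x hx => ?_⟩,
    fun q p => ⟨WStarGroupoid.isBanachAtlas_arrowsChart q p,
      WStarGroupoid.isComplexificationOf_arrowsChart q p⟩⟩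
  · obtain ⟨q, p, hqp, hx⟩ := hpair x
    obtain ⟨d, hd, hxd, -⟩ := hchart q p hqp x hx
    exact ⟨d, hd, hxd⟩
  · refine BanachManifold.isBanachAtlas_of_subset_inducedCharts
      WStarGroupoid.isBanachAtlas_groupoidAtlas.realAtlas (fun d hd => hd.1) fun x => ?_
    obtain ⟨q, p, hqp, hx⟩ := hpair x
    obtain ⟨d, hd, hxd, hs, hm⟩ := hchart q p hqp x hx
    exact ⟨d, ⟨hd, q, p, hqp, hs, hm⟩, hxd⟩
  · obtain ⟨d, hd, hxd, hs, hm⟩ := hchart q p hqp x hx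
    exact ⟨d, ⟨hd, q, p, hqp, hs, hm⟩, hxd, hs, hm⟩
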